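/- \textbf{Setting.} Let $d\ge 1$, $\Theta=[\theta_{\inf},\theta_{\sup}]^p\subset\mathbb{R}^p$, and let $\theta_0\in\Theta$ satisfy $\theta_{\inf}<(\theta_0)_i<\theta_{\sup}$ for $1\le i\le p$. Let $\{K_\theta,\theta\in\Theta\}$ be a family of functions $K_\theta:\mathbb{R}^d\to\mathbb{R}$ such that: \begin{itemize} \item each $K_\theta$ is a stationary covariance function; \item $K_\theta(t)$ is three times differentiable with respect to $\theta\in\Theta$, and for all $q\in\{0,\dots,3\}$ and $i_1,\dots,i_q\in\{1,\dots,p\}$ there is $C_{i_1,\dots,i_q}<\infty$ such that $\left|\frac{\partial}{\partial\theta_{i_1}}\cdots\frac{\partial}{\partial\theta_{i_q}}K_\theta(t)\right|\le \frac{C_{i_1,\dots,i_q}}{1+|t|^{d+1}}$ for all $\theta\in\Theta$, $t\in\mathbb{R}^d$ ($|t|$ is the Euclidean norm); \item with $\hat K_\theta(f)=\frac1{(2\pi)^d}\int_{\mathbb{R}^d}K_\theta(t)e^{-\mathrm{i}f\cdot t}\,dt$, one has $K_\theta(t)=\int_{\mathbb{R}^d}\hat K_\theta(f)e^{\mathrm{i}f\cdot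 t}\,df$ (both integrals being absolutely convergent), and $(f,\theta)\mapsto\hat K_\theta(f)$ is real valued, positive and continuous on $\mathbb{R}^d\times\Theta$. \end{itemize} Let $(v_i)_{i\ge1}$ be a deterministic sequence in $\{1,2,\dots\}^d$ with $\{v_i:1\le i\le N^d\}=\{1,\dots,N\}^d$ for all $N\ge1$, and let $\epsilon\in[0,\frac12)$. Let $(X_i)_{i\ge1}$ be i.i.d. with law $\mathcal{L}_X$, a symmetric probability distribution on $\mathbb{R}^d$ whose support $S_X$ is contained in $[-1,1]^d$ and which has a probability density that is positive on $S_X$. Let $Y$ be a centered Gaussian process on $\mathbb{R}^d$ with covariance function $(s,t)\mapsto K_{\theta_0}(s-t)$, independent of $(X_i)$ in the sense that $(X_i)$ and $Y$ are defined on the two factors of a product probability space. The observations are $y_i=Y(v_i+\epsilon X_i)$, $1\le i\le n$. For $\theta\in\Theta$ let $\hat y_{i,\theta}(y_{-i})$ be the leave-one-out Kriging prediction of $y_i$, i.e. the conditional mean, given $X$ and $y_j$ ($1\le j\le n$, $j\ne i$), of $y_i$ under the covariance function $K_\theta$: explicitly $\hat y_{i,\theta}(y_{-i})=r_{i,\theta}^t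 R_{-i,\theta}^{-1}y_{-i}$, where $R_\theta=\big(K_\theta(v_j-v_k+\epsilon(X_j-X_k))\big)_{1\le j,k\le n}$, $R_{-i,\theta}$ is $R_\theta$ without its $i$-th row and column, and $r_{i,\theta}$ is the $i$-th column of $R_\theta$ without its $i$-th entry. For each $n\ge1$ let $\hat\theta_{CV}=\hat\theta_{CV,n}$ be any element of $$\mathop{\mathrm{argmin}}_{\theta\in\Theta}\ \sum_{i=1}^n\{y_i-\hat y_{i,\theta}(y_{-i})\}^2 \quad\text{(almost surely)}.$$ \textbf{Proposition.} Assume moreover that $K_\theta(0)=1$ for all $\theta\in\Theta$. \begin{enumerate} \item If $\epsilon=0$ and there is no $\theta\in\Theta$, $\theta\ne\theta_0$, with $K_\theta(v)=K_{\theta_0}(v)$ for all $v\in\mathbb{Z}^d$, then $\hat\theta_{CV}\to\theta_0$ in probability as $n\to\infty$. \item If $\epsilon\neq0$, let $D_\epsilon=\bigcup_{v\in\mathbb{Z}^d\setminus\{0\}}(v+\epsilon C_{S_X})$ with $C_{S_X}=\{t_1-t_2:t_1,t_2\in S_X\}$. If there is no $\theta\in\Theta$, $\theta\ne\theta_0$,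 with $K_\theta=K_{\theta_0}$ Lebesgue-almost everywhere on $D_\epsilon$, then $\hat\theta_{CV}\to\theta_0$ in probability as $n\to\infty$. \end{enumerate} -/

import Mathlib

open MeasureTheory ProbabilityTheory Filter Topology
open scoped Matrix ENNReal

noncomputable section

/-! ### The parametric covariance model -/

/-- The parameter space `Θ = [a, b]^p`. -/
def paramCube (p : ℕ) (a b : ℝ) : Set (Fin p → ℝ) :=
  {θ | ∀ i, θ i ∈ Set.Icc a b}

/-- `k` is the covariance function `(s, t) ↦ k (s - t)` of a real second order stationary process
on `ℝ^d`: it is even and positive semidefinite. -/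
def IsStationaryCovariance {d : ℕ} (k : EuclideanSpace ℝ (Fin d) → ℝ) : Prop :=
  (∀ t, k (-t) = k t) ∧
    ∀ (n : ℕ) (s : Fin n → EuclideanSpace ℝ (Fin d)) (c : Fin n → ℝ),
      0 ≤ ∑ i, ∑ j, c i * c j * k (s i - s j)

/-- The Fourier transform `ĥ(f) = (2π)^{-d} ∫ h(t) e^{-i f·t} dt`. -/
def fourierHat {d : ℕ} (h : EuclideanSpace ℝ (Fin d) → ℝ) (f : EuclideanSpace ℝ (Fin d)) : ℂ :=
  (1 / (2 * (Real.pi : ℂ)) ^ d) *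
    ∫ t, (h t : ℂ) * Complex.exp (-Complex.I * ((inner ℝ f t : ℝ) : ℂ))

/-- The regularity condition on a parametric family `K θ`, `θ ∈ Θ = [a, b]^p`, of covariance
functions on `ℝ^d`. Only the values of `K` at parameters in `Θ` matter; derivatives in `θ` are
taken within `Θ` (so they are one-sided on its boundary). -/
structure IsRegularCovarianceModel {d p : ℕ} (a b : ℝ)
    (K : (Fin p → ℝ) → EuclideanSpace ℝ (Fin d) → ℝ) : Prop where
  stationary : ∀ θ ∈ paramCube p a b, IsStationaryCovariance (K θ)
  /-- Three times differentiable in `θ`: the derivatives of orders `0, 1, 2` are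
  differentiable. -/
  differentiable : ∀ (t : EuclideanSpace ℝ (Fin d)), ∀ q < 3,
    DifferentiableOn ℝ (iteratedFDerivWithin ℝ q (fun θ => K θ t) (paramCube p a b))
      (paramCube p a b)
  /-- All the partial derivatives `∂/∂θ_{i 0} ⋯ ∂/∂θ_{i (q-1)} K θ t` of order `q ≤ 3` are
  dominated by `C / (1 + |t|^{d+1})`, uniformly in `θ` and `t`. -/
  bound : ∀ q ≤ 3, ∀ i : Fin q → Fin p, ∃ C : ℝ, ∀ θ ∈ paramCube p a b,
    ∀ t : EuclideanSpace ℝ (Fin d),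
      |iteratedFDerivWithin ℝ q (fun θ' => K θ' t) (paramCube p a b) θ
          (fun j => Pi.single (i j) (1 : ℝ))| ≤ C / (1 + ‖t‖ ^ (d + 1))
  /-- The Fourier transform is defined by a convergent integral. -/
  integrable : ∀ θ ∈ paramCube p a b, Integrable (K θ)
  /-- The Fourier inversion integral converges. -/
  integrable_hat : ∀ θ ∈ paramCube p a b, Integrable (fourierHat (K θ))
  inversion : ∀ θ ∈ paramCube p a b, ∀ t : EuclideanSpace ℝ (Fin d),
    (K θ t : ℂ) =
      ∫ f, fourierHat (K θ) f * Complex.exp (Complex.I * ((inner ℝ f t : ℝ) : ℂ))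
  hat_continuous : ContinuousOn
    (fun x : EuclideanSpace ℝ (Fin d) × (Fin p → ℝ) => fourierHat (K x.2) x.1)
    (Set.univ ×ˢ paramCube p a b)
  /-- The Fourier transform is real and positive. -/
  hat_pos : ∀ θ ∈ paramCube p a b, ∀ f : EuclideanSpace ℝ (Fin d),
    0 < (fourierHat (K θ) f).re ∧ (fourierHat (K θ) f).im = 0

/-! ### The randomly perturbed regular grid -/

/-- `v` enumerates `{1, 2, …}^d` so that, for every `N ≥ 1`, its first `N^d` terms are exactly the
points of `{1, …, N}^d` (indices start at `0`). -/
def IsGridEnumeration {d : ℕ} (v : ℕ → Fin d → ℕ) : Prop :=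
  ∀ N : ℕ, 1 ≤ N → v '' {i | i < N ^ d} = {u | ∀ k, 1 ≤ u k ∧ u k ≤ N}

/-- The law of the perturbations: a symmetric probability distribution whose (topological) support
lies in `[-1, 1]^d`, with a probability density that is positive on the support. -/
structure IsPerturbationLaw {d : ℕ} (L : Measure (EuclideanSpace ℝ (Fin d))) : Prop where
  prob : IsProbabilityMeasure L
  symm : L.map (fun x => -x) = L
  support_subset : ∀ x ∈ L.support, ∀ k, x k ∈ Set.Icc (-1 : ℝ) 1
  density : ∃ f : EuclideanSpace ℝ (Fin d) → ℝ≥0∞, Measurable f ∧ L = volume.withDensity f ∧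
    ∀ x ∈ L.support, 0 < f x

/-- The observation point `v_i + ε x_i`. -/
def obsPoint {d : ℕ} (v : ℕ → Fin d → ℕ) (ε : ℝ) (x : ℕ → EuclideanSpace ℝ (Fin d)) (i : ℕ) :
    EuclideanSpace ℝ (Fin d) :=
  WithLp.toLp 2 (fun k => (v i k : ℝ)) + ε • x i

/-- The set `D_ε = ⋃_{v ∈ ℤ^d, v ≠ 0} (v + ε C_S)`, where `C_S = {t₁ - t₂ : t₁, t₂ ∈ S}`. -/
def interpointSet {d : ℕ} (ε : ℝ) (S : Set (EuclideanSpace ℝ (Fin d))) :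
    Set (EuclideanSpace ℝ (Fin d)) :=
  {t | ∃ v : Fin d → ℤ, v ≠ 0 ∧ ∃ t₁ ∈ S, ∃ t₂ ∈ S,
    t = WithLp.toLp 2 (fun k => (v k : ℝ)) + ε • (t₁ - t₂)}

/-- `Y` is a centered Gaussian process on `ℝ^d` with covariance function `(s, t) ↦ k (s - t)`. -/
structure IsCenteredGaussianProcess {d : ℕ} {Ω : Type*} [MeasurableSpace Ω]
    (Y : EuclideanSpace ℝ (Fin d) → Ω → ℝ) (P : Measure Ω)
    (k : EuclideanSpace ℝ (Fin d) → ℝ) : Prop where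
  gaussian : IsGaussianProcess Y P
  centered : ∀ t, ∫ ω, Y t ω ∂P = 0
  covariance : ∀ s t, cov[Y s, Y t; P] = k (s - t)

/-! ### Leave-one-out Kriging and the cross validation criterion -/

/-- The covariance matrix `R_{i,j} = k (s_i - s_j)` of the observations at the points `s_i`. -/
def covMatrix {d n : ℕ} (k : EuclideanSpace ℝ (Fin d) → ℝ)
    (s : Fin n → EuclideanSpace ℝ (Fin d)) : Matrix (Fin n) (Fin n) ℝ :=
  Matrix.of fun i j => k (s i - s j)

/-- The (simple) Kriging prediction of the `i`-th coordinate of a centered Gaussian vector with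
covariance matrix `R` from its other coordinates `z`, that is `r_iᵀ R_{-i}⁻¹ z`, with `R_{-i}` the
matrix `R` without its `i`-th row and column and `r_i` the `i`-th row of `R` without its `i`-th
entry. It is the conditional mean: see `condExp_eq_krigingLOO`. -/
def krigingLOO {n : ℕ} (R : Matrix (Fin n) (Fin n) ℝ) (i : Fin n) (z : {j // j ≠ i} → ℝ) : ℝ :=
  (fun j : {j // j ≠ i} => R i j) ⬝ᵥ
    ((R.submatrix (fun j : {j // j ≠ i} => (j : Fin n)) (fun j : {j // j ≠ i} => (j : Fin n)))⁻¹
      *ᵥ z)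

/-- For a centered Gaussian vector `Z` with covariance matrix `R` (with `R_{-i}` invertible), the
Kriging prediction is the conditional expectation of `Z_i` given the `Z_j`, `j ≠ i`. -/
theorem condExp_eq_krigingLOO {n : ℕ} {Ω : Type*} [mΩ : MeasurableSpace Ω] (P : Measure Ω)
    [IsProbabilityMeasure P] (Z : Fin n → Ω → ℝ) (hZm : ∀ i, Measurable (Z i))
    (hZ : HasGaussianLaw (fun ω i => Z i ω) P) (hZ0 : ∀ i, ∫ ω, Z i ω ∂P = 0)
    (R : Matrix (Fin n) (Fin n) ℝ) (hR : ∀ i j, cov[Z i, Z j; P] = R i j) (i : Fin n)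
    (hdet : IsUnit (R.submatrix (fun j : {j // j ≠ i} => (j : Fin n))
      (fun j : {j // j ≠ i} => (j : Fin n))).det) :
    P[Z i | MeasurableSpace.comap (fun ω (j : {j // j ≠ i}) => Z j ω) inferInstance] =ᵐ[P]
      fun ω => krigingLOO R i (fun j => Z j ω) := by
  classical
  set A := R.submatrix (fun j : {j // j ≠ i} => (j : Fin n)) (fun j : {j // j ≠ i} => (j : Fin n))
    with hA
  -- the weights of the linear prediction
  set w : {j // j ≠ i} → ℝ := (fun j : {j // j ≠ i} => R i j) ᵥ* A⁻¹ with hw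
  have hpred : ∀ z : {j // j ≠ i} → ℝ, krigingLOO R i z = ∑ j, w j * z j := by
    intro z
    simp only [krigingLOO]
    rw [Matrix.dotProduct_mulVec]
    rfl
  have hwA : w ᵥ* A = fun j : {j // j ≠ i} => R i j := by
    rw [hw, Matrix.vecMul_vecMul, Matrix.nonsing_inv_mul _ hdet, Matrix.vecMul_one]
  have hL2 : ∀ j, MemLp (Z j) 2 P := fun j => (hZ.eval j).memLp_two
  set V : Ω → {j // j ≠ i} → ℝ := fun ω j => Z j ω with hV
  have hVm : Measurable V := measurable_pi_lambda _ fun j => hZm j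
  set W : Ω → ℝ := fun ω => Z i ω - ∑ j : {j // j ≠ i}, w j * Z j ω with hW
  have hWm : Measurable W :=
    (hZm i).sub (Finset.measurable_sum _ fun j _ => (hZm j).const_mul _)
  have hpm : Measurable[MeasurableSpace.comap V inferInstance]
      (fun ω => ∑ j : {j // j ≠ i}, w j * Z j ω) := by
    have h : Measurable (fun z : {j // j ≠ i} → ℝ => ∑ j, w j * z j) := by fun_prop
    exact h.comp (comap_measurable V)
  have hpi : Integrable (fun ω => ∑ j : {j // j ≠ i}, w j * Z j ω) P :=
    integrable_finsetSum _ fun j _ => ((hZ.eval j).integrable).const_mul _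
  have hWi : Integrable W P := (hZ.eval i).integrable.sub hpi
  -- joint Gaussianity and zero covariance give independence
  have hjoint : HasGaussianLaw (fun ω => ((fun _ : Unit => W ω), V ω)) P := by
    let T : (Fin n → ℝ) →ₗ[ℝ] (Unit → ℝ) × ({j // j ≠ i} → ℝ) :=
      { toFun := fun z => ((fun _ => z i - ∑ j : {j // j ≠ i}, w j * z j), fun j => z j)
        map_add' := by
          intro x y
          refine Prod.ext (funext fun _ => ?_) rfl
          simp only [Pi.add_apply, Prod.fst_add, mul_add, Finset.sum_add_distrib]
          ring
        map_smul' := by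
          intro c x
          refine Prod.ext (funext fun _ => ?_) rfl
          simp only [Pi.smul_apply, Prod.smul_fst, smul_eq_mul, RingHom.id_apply, mul_sub,
            Finset.mul_sum]
          congr 1
          exact Finset.sum_congr rfl fun j _ => by ring }
    exact hZ.map_fun T.toContinuousLinearMap
  have hcov : ∀ j : {j // j ≠ i}, cov[W, Z j; P] = 0 := by
    intro j
    have h1 : cov[W, Z j; P] = cov[Z i, Z j; P] -
        cov[fun ω => ∑ l : {j // j ≠ i}, w l * Z l ω, Z j; P] :=
      covariance_fun_sub_left (hL2 i)
        (memLp_finsetSum _ fun l _ => (hL2 l).const_mul _) (hL2 j)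
    rw [h1, covariance_fun_sum_left (X := fun (l : {j // j ≠ i}) ω => w l * Z l ω)
      (fun l => (hL2 l).const_mul _) (hL2 j)]
    simp only [covariance_const_mul_left, hR]
    have h2 := congrFun hwA j
    simp only [Matrix.vecMul, dotProduct, hA, Matrix.submatrix_apply] at h2
    rw [h2, sub_self]
  have hindep : IndepFun (fun ω (_ : Unit) => W ω) V P :=
    hjoint.indepFun_of_covariance_eval fun _ j => hcov j
  have hindep' : IndepFun W V P :=
    hindep.comp (φ := fun f : Unit → ℝ => f ()) (measurable_pi_apply _) measurable_id
  have hW0 : ∫ ω, W ω ∂P = 0 := by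
    rw [hW, integral_sub (hZ.eval i).integrable hpi, hZ0 i,
      integral_finsetSum (f := fun (j : {j // j ≠ i}) ω => w j * Z j ω) _
        fun j _ => ((hZ.eval j).integrable).const_mul _]
    simp [integral_const_mul, hZ0]
  have hce : P[W | MeasurableSpace.comap V inferInstance] =ᵐ[P] fun _ => (0 : ℝ) := by
    have h := condExp_indep_eq (μ := P) (f := W) hWm.comap_le hVm.comap_le
      (comap_measurable W).stronglyMeasurable hindep'
    rwa [hW0] at h
  have hdec : Z i = W + fun ω => ∑ j : {j // j ≠ i}, w j * Z j ω := by
    funext ω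
    simp [hW]
  have hadd := condExp_add hWi hpi (MeasurableSpace.comap V inferInstance)
  rw [← hdec, condExp_of_stronglyMeasurable hVm.comap_le hpm.stronglyMeasurable hpi] at hadd
  filter_upwards [hadd, hce] with ω h1 h2
  rw [h1, Pi.add_apply, h2, zero_add, hpred]

/-- The cross validation criterion: the sum of the squared leave-one-out Kriging errors
`∑ i, (y_i - ŷ_i(y_{-i}))²`, where the prediction uses the covariance function `k` at the
points `s_i`. -/
def cvCriterion {d n : ℕ} (k : EuclideanSpace ℝ (Fin d) → ℝ)
    (s : Fin n → EuclideanSpace ℝ (Fin d)) (y : Fin n → ℝ) : ℝ :=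
  ∑ i, (y i - krigingLOO (covMatrix k s) i (fun j => y j)) ^ 2

/-- `θhat n` is, for every sample size `n ≥ 1`, almost surely a global minimizer over `Θ` of the
cross validation criterion built from the observations `y_i = Y(v_i + ε X_i)`, `i < n`. The sample
space is the product of the one carrying the perturbations `X` and the one carrying `Y`. -/
def IsCVEstimator {d p : ℕ} {ΩX ΩY : Type*} [MeasurableSpace ΩX] [MeasurableSpace ΩY]
    (a b : ℝ) (K : (Fin p → ℝ) → EuclideanSpace ℝ (Fin d) → ℝ) (v : ℕ → Fin d → ℕ) (ε : ℝ)
    (PX : Measure ΩX) (X : ℕ → ΩX → EuclideanSpace ℝ (Fin d))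
    (PY : Measure ΩY) (Y : EuclideanSpace ℝ (Fin d) → ΩY → ℝ)
    (θhat : ℕ → ΩX × ΩY → Fin p → ℝ) : Prop :=
  ∀ n : ℕ, 1 ≤ n → ∀ᵐ ω ∂(PX.prod PY),
    θhat n ω ∈ paramCube p a b ∧
      ∀ θ ∈ paramCube p a b,
        cvCriterion (K (θhat n ω)) (fun i : Fin n => obsPoint v ε (fun j => X j ω.1) i)
            (fun i : Fin n => Y (obsPoint v ε (fun j => X j ω.1) i) ω.2) ≤
          cvCriterion (K θ) (fun i : Fin n => obsPoint v ε (fun j => X j ω.1) i)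
            (fun i : Fin n => Y (obsPoint v ε (fun j => X j ω.1) i) ω.2)

end

/-! ### Operator and Frobenius norm estimates for real matrices -/

section MatrixEstimates

open scoped Matrix.Norms.L2Operator

variable {m : Type*} [Fintype m]

theorem EuclideanSpace.norm_toLp_sq (x : m → ℝ) : ‖WithLp.toLp 2 x‖ ^ 2 = x ⬝ᵥ x := by
  rw [EuclideanSpace.norm_sq_eq]
  simp [dotProduct, sq]

/-- The squared Frobenius norm. -/
def Matrix.frobSq (M : Matrix m m ℝ) : ℝ := ∑ i, ∑ j, M i j ^ 2

theorem Matrix.frobSq_nonneg (M : Matrix m m ℝ) : 0 ≤ M.frobSq :=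
  Finset.sum_nonneg fun _ _ => Finset.sum_nonneg fun _ _ => sq_nonneg _

theorem Matrix.frobSq_transpose (M : Matrix m m ℝ) : Mᵀ.frobSq = M.frobSq :=
  Finset.sum_comm

theorem Matrix.frobSq_eq_sum_col (M : Matrix m m ℝ) :
    M.frobSq = ∑ j, (fun i => M i j) ⬝ᵥ (fun i => M i j) := by
  rw [Matrix.frobSq, Finset.sum_comm]
  simp [dotProduct, sq]

theorem Matrix.frobSq_add_le (A B : Matrix m m ℝ) :
    (A + B).frobSq ≤ 2 * A.frobSq + 2 * B.frobSq := by
  simp only [Matrix.frobSq, Finset.mul_sum, ← Finset.sum_add_distrib, Matrix.add_apply]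
  gcongr with i _ j _
  nlinarith [sq_nonneg (A i j - B i j)]

variable [DecidableEq m]

theorem Matrix.mulVec_dotProduct_mulVec_le (M : Matrix m m ℝ) (x : m → ℝ) :
    (M *ᵥ x) ⬝ᵥ (M *ᵥ x) ≤ ‖M‖ ^ 2 * (x ⬝ᵥ x) := by
  have h := Matrix.l2_opNorm_mulVec M (WithLp.toLp 2 x)
  rw [← EuclideanSpace.norm_toLp_sq, ← EuclideanSpace.norm_toLp_sq, ← mul_pow]
  exact pow_le_pow_left₀ (norm_nonneg _) h 2

theorem Matrix.l2_opNorm_le_of_mulVec {M : Matrix m m ℝ} {c : ℝ} (hc : 0 ≤ c)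
    (h : ∀ x, (M *ᵥ x) ⬝ᵥ (M *ᵥ x) ≤ c ^ 2 * (x ⬝ᵥ x)) : ‖M‖ ≤ c := by
  rw [Matrix.cstar_norm_def]
  refine ContinuousLinearMap.opNorm_le_bound _ hc fun x => ?_
  have h1 := h x.ofLp
  rw [← EuclideanSpace.norm_toLp_sq, ← EuclideanSpace.norm_toLp_sq, ← mul_pow] at h1
  exact le_of_sq_le_sq h1 (by positivity)

theorem Matrix.l2_opNorm_le_of_row_sum {M : Matrix m m ℝ} (hM : Mᵀ = M) {c : ℝ} (hc : 0 ≤ c)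
    (h : ∀ i, ∑ j, |M i j| ≤ c) : ‖M‖ ≤ c := by
  refine Matrix.l2_opNorm_le_of_mulVec hc fun x => ?_
  have h1 : ∀ i, (M *ᵥ x) i ^ 2 ≤ c * ∑ j, |M i j| * x j ^ 2 := by
    intro i
    have h2 : (M *ᵥ x) i ^ 2 ≤ (∑ j, |M i j|) * ∑ j, |M i j| * x j ^ 2 := by
      refine Finset.sum_sq_le_sum_mul_sum_of_sq_le_mul _ (fun j _ => abs_nonneg _)
        (fun j _ => by positivity) fun j _ => ?_
      rw [mul_pow, ← sq_abs (M i j)]; exact le_of_eq (by ring)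
    exact h2.trans (mul_le_mul_of_nonneg_right (h i)
      (Finset.sum_nonneg fun j _ => by positivity))
  calc (M *ᵥ x) ⬝ᵥ (M *ᵥ x) = ∑ i, (M *ᵥ x) i ^ 2 := by simp [dotProduct, sq]
    _ ≤ ∑ i, c * ∑ j, |M i j| * x j ^ 2 := Finset.sum_le_sum fun i _ => h1 i
    _ = c * ∑ j, (∑ i, |M j i|) * x j ^ 2 := by
        rw [← Finset.mul_sum, Finset.sum_comm]
        congr 1
        refine Finset.sum_congr rfl fun j _ => ?_
        rw [Finset.sum_mul]
        refine Finset.sum_congr rfl fun i _ => ?_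
        rw [← congrFun (congrFun hM i) j, Matrix.transpose_apply]
    _ ≤ c * ∑ j, c * x j ^ 2 := by
        gcongr with j _
        exact h j
    _ = c ^ 2 * (x ⬝ᵥ x) := by
        rw [← Finset.mul_sum, dotProduct]; simp only [sq, mul_assoc]

theorem Matrix.frobSq_mul_le_left (A B : Matrix m m ℝ) :
    (A * B).frobSq ≤ ‖A‖ ^ 2 * B.frobSq := by
  rw [Matrix.frobSq_eq_sum_col, Matrix.frobSq_eq_sum_col, Finset.mul_sum]
  exact Finset.sum_le_sum fun j _ => A.mulVec_dotProduct_mulVec_le fun i => B i j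

theorem Matrix.l2_opNorm_transpose (A : Matrix m m ℝ) : ‖Aᵀ‖ = ‖A‖ := by
  rw [← Matrix.l2_opNorm_conjTranspose A, Matrix.conjTranspose_eq_transpose_of_trivial]

theorem Matrix.frobSq_mul_le_right (A B : Matrix m m ℝ) :
    (A * B).frobSq ≤ ‖B‖ ^ 2 * A.frobSq := by
  rw [← Matrix.frobSq_transpose, Matrix.transpose_mul, ← Matrix.l2_opNorm_transpose B,
    ← Matrix.frobSq_transpose A]
  exact Matrix.frobSq_mul_le_left _ _

theorem Matrix.l2_opNorm_diagonal_le {v : m → ℝ} {c : ℝ} (hc : 0 ≤ c) (h : ∀ i, |v i| ≤ c) :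
    ‖(Matrix.diagonal v : Matrix m m ℝ)‖ ≤ c := by
  rw [Matrix.l2_opNorm_diagonal]
  exact (pi_norm_le_iff_of_nonneg hc).2 h

theorem Matrix.abs_apply_le_l2_opNorm (A : Matrix m m ℝ) (i j : m) : |A i j| ≤ ‖A‖ := by
  have h := A.mulVec_dotProduct_mulVec_le (Pi.single j 1)
  have h1 : A i j ^ 2 ≤ ‖A‖ ^ 2 := by
    simp only [Matrix.mulVec_single_one, dotProduct_single_one, Pi.single_eq_same, mul_one] at h
    refine le_trans ?_ h
    rw [sq]
    exact Finset.single_le_sum (f := fun k => A.col j k * A.col j k)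
      (fun k _ => mul_self_nonneg _) (Finset.mem_univ i)
  exact abs_le_of_sq_le_sq h1 (norm_nonneg _)

/-- `R` is symmetric with eigenvalues in `[l, u]`. -/
structure Matrix.SpectrumIn (R : Matrix m m ℝ) (l u : ℝ) : Prop where
  symm : Rᵀ = R
  lower : ∀ x, l * (x ⬝ᵥ x) ≤ x ⬝ᵥ R *ᵥ x
  upper : ‖R‖ ≤ u

namespace Matrix.SpectrumIn

variable {R R₀ : Matrix m m ℝ} {l u : ℝ}

theorem posDef (h : R.SpectrumIn l u) (hl : 0 < l) : R.PosDef := by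
  refine Matrix.PosDef.of_dotProduct_mulVec_pos ?_ fun x hx => ?_
  · rw [Matrix.IsHermitian, Matrix.conjTranspose_eq_transpose_of_trivial, h.symm]
  · rw [star_trivial]
    refine lt_of_lt_of_le (mul_pos hl ?_) (h.lower x)
    exact lt_of_le_of_ne (Finset.sum_nonneg fun i _ => mul_self_nonneg _)
      fun h0 => hx (dotProduct_self_eq_zero.1 h0.symm)

theorem isUnit_det (h : R.SpectrumIn l u) (hl : 0 < l) : IsUnit R.det :=
  (h.posDef hl).det_pos.ne'.isUnit

theorem mul_inv (h : R.SpectrumIn l u) (hl : 0 < l) : R * R⁻¹ = 1 :=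
  Matrix.mul_nonsing_inv _ (h.isUnit_det hl)

theorem inv_mul (h : R.SpectrumIn l u) (hl : 0 < l) : R⁻¹ * R = 1 :=
  Matrix.nonsing_inv_mul _ (h.isUnit_det hl)

theorem norm_inv_le (h : R.SpectrumIn l u) (hl : 0 < l) : ‖R⁻¹‖ ≤ 1 / l := by
  refine Matrix.l2_opNorm_le_of_mulVec (by positivity) fun x => ?_
  set y := R⁻¹ *ᵥ x with hy
  have hx : R *ᵥ y = x := by
    rw [hy, Matrix.mulVec_mulVec, h.mul_inv hl, Matrix.one_mulVec]
  have h1 := h.lower y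
  rw [hx] at h1
  have h2 : (y ⬝ᵥ x) ^ 2 ≤ (y ⬝ᵥ y) * (x ⬝ᵥ x) := by
    have := Finset.sum_mul_sq_le_sq_mul_sq Finset.univ y x
    simpa only [dotProduct, sq] using this
  have hy0 : 0 ≤ y ⬝ᵥ y := Finset.sum_nonneg fun i _ => mul_self_nonneg _
  rw [one_div, inv_pow, ← div_eq_inv_mul, le_div_iff₀ (by positivity)]
  rcases hy0.eq_or_lt with h0 | h0
  · rw [← h0, zero_mul]; exact Finset.sum_nonneg fun i _ => mul_self_nonneg _
  · refine le_of_mul_le_mul_left ?_ h0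
    calc (y ⬝ᵥ y) * ((y ⬝ᵥ y) * l ^ 2) = (l * (y ⬝ᵥ y)) ^ 2 := by ring
      _ ≤ (y ⬝ᵥ x) ^ 2 := pow_le_pow_left₀ (by positivity) h1 2
      _ ≤ _ := h2

theorem le_inv_apply_self (h : R.SpectrumIn l u) (hl : 0 < l) (hu : 0 < u) (i : m) :
    l / u ^ 2 ≤ R⁻¹ i i := by
  set y := R⁻¹ *ᵥ (Pi.single i 1) with hy
  have hx : R *ᵥ y = Pi.single i 1 := by
    rw [hy, Matrix.mulVec_mulVec, h.mul_inv hl, Matrix.one_mulVec]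
  have h1 := h.lower y
  rw [hx] at h1
  have hyi : y ⬝ᵥ Pi.single i 1 = R⁻¹ i i := by
    simp [hy]
  have h2 := R.mulVec_dotProduct_mulVec_le y
  rw [hx] at h2
  have h3 : (1 : ℝ) ≤ u ^ 2 * (y ⬝ᵥ y) := by
    have h4 : (Pi.single i 1 : m → ℝ) ⬝ᵥ Pi.single i 1 = 1 := by simp
    rw [h4] at h2
    refine h2.trans (mul_le_mul_of_nonneg_right
      (pow_le_pow_left₀ (norm_nonneg _) h.upper 2) ?_)
    exact Finset.sum_nonneg fun i _ => mul_self_nonneg _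
  rw [hyi] at h1
  rw [div_le_iff₀ (by positivity)]
  nlinarith [mul_le_mul_of_nonneg_left h3 hl.le, mul_le_mul_of_nonneg_right h1 (sq_nonneg u)]

theorem inv_apply_self_pos (h : R.SpectrumIn l u) (hl : 0 < l) (hu : 0 < u) (i : m) :
    0 < R⁻¹ i i :=
  lt_of_lt_of_le (by positivity) (h.le_inv_apply_self hl hu i)

theorem inv_apply_self_le (h : R.SpectrumIn l u) (hl : 0 < l) (i : m) : R⁻¹ i i ≤ 1 / l :=
  (le_abs_self _).trans ((R⁻¹.abs_apply_le_l2_opNorm i i).trans (h.norm_inv_le hl))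

end Matrix.SpectrumIn

/-! ### The leave-one-out residual matrix -/

/-- The inverse of the diagonal part of `R⁻¹`. -/
noncomputable def Matrix.looDiag (R : Matrix m m ℝ) : Matrix m m ℝ :=
  Matrix.diagonal fun i => (R⁻¹ i i)⁻¹

/-- The matrix mapping the observations to their leave-one-out residuals. -/
noncomputable def Matrix.looMatrix (R : Matrix m m ℝ) : Matrix m m ℝ := R.looDiag * R⁻¹

namespace Matrix.SpectrumIn

variable {R R₀ : Matrix m m ℝ} {l u : ℝ}

theorem norm_looDiag_le (h : R.SpectrumIn l u) (hl : 0 < l) (hu : 0 < u) :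
    ‖R.looDiag‖ ≤ u ^ 2 / l := by
  refine Matrix.l2_opNorm_diagonal_le (by positivity) fun i => ?_
  rw [abs_of_pos (inv_pos.2 (h.inv_apply_self_pos hl hu i)), inv_le_comm₀
    (h.inv_apply_self_pos hl hu i) (by positivity), inv_div]
  exact h.le_inv_apply_self hl hu i

theorem norm_looMatrix_le (h : R.SpectrumIn l u) (hl : 0 < l) (hu : 0 < u) :
    ‖R.looMatrix‖ ≤ u ^ 2 / l ^ 2 := by
  calc ‖R.looMatrix‖ ≤ ‖R.looDiag‖ * ‖R⁻¹‖ := norm_mul_le _ _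
    _ ≤ (u ^ 2 / l) * (1 / l) := by
        gcongr
        exacts [h.norm_looDiag_le hl hu, h.norm_inv_le hl]
    _ = u ^ 2 / l ^ 2 := by field_simp

theorem norm_inv_sub_inv_le (h : R.SpectrumIn l u) (h₀ : R₀.SpectrumIn l u) (hl : 0 < l) :
    ‖R⁻¹ - R₀⁻¹‖ ≤ 1 / l ^ 2 * ‖R - R₀‖ := by
  have e : R⁻¹ - R₀⁻¹ = R⁻¹ * (R₀ - R) * R₀⁻¹ := by
    rw [mul_sub, sub_mul, h.inv_mul hl, mul_assoc, h₀.mul_inv hl, one_mul, mul_one]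
  rw [e]
  calc ‖R⁻¹ * (R₀ - R) * R₀⁻¹‖ ≤ ‖R⁻¹‖ * ‖R₀ - R‖ * ‖R₀⁻¹‖ :=
        (norm_mul_le _ _).trans (by gcongr; exact norm_mul_le _ _)
    _ ≤ 1 / l * ‖R₀ - R‖ * (1 / l) := by
        gcongr
        exacts [h.norm_inv_le hl, h₀.norm_inv_le hl]
    _ = 1 / l ^ 2 * ‖R - R₀‖ := by rw [norm_sub_rev]; field_simp

theorem norm_looMatrix_sub_le (h : R.SpectrumIn l u) (h₀ : R₀.SpectrumIn l u) (hl : 0 < l)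
    (hu : 0 < u) :
    ‖R.looMatrix - R₀.looMatrix‖ ≤ (u ^ 2 / l ^ 3 + u ^ 4 / l ^ 5) * ‖R - R₀‖ := by
  have hinv := h.norm_inv_sub_inv_le h₀ hl
  have hD : ‖R.looDiag - R₀.looDiag‖ ≤ (u ^ 2 / l) ^ 2 * (1 / l ^ 2 * ‖R - R₀‖) := by
    rw [Matrix.looDiag, Matrix.looDiag, Matrix.diagonal_sub]
    refine Matrix.l2_opNorm_diagonal_le (by positivity) fun i => ?_
    have p := h.inv_apply_self_pos hl hu i
    have p₀ := h₀.inv_apply_self_pos hl hu i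
    have q : (R⁻¹ i i)⁻¹ ≤ u ^ 2 / l := by
      rw [inv_le_comm₀ p (by positivity), inv_div]; exact h.le_inv_apply_self hl hu i
    have q₀ : (R₀⁻¹ i i)⁻¹ ≤ u ^ 2 / l := by
      rw [inv_le_comm₀ p₀ (by positivity), inv_div]; exact h₀.le_inv_apply_self hl hu i
    have e : (R⁻¹ i i)⁻¹ - (R₀⁻¹ i i)⁻¹ =
        -((R⁻¹ i i)⁻¹ * (R₀⁻¹ i i)⁻¹ * ((R⁻¹ - R₀⁻¹) i i)) := by
      rw [Matrix.sub_apply]; field_simp; ring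
    rw [e, abs_neg, abs_mul, abs_mul, abs_of_pos (inv_pos.2 p), abs_of_pos (inv_pos.2 p₀), sq]
    gcongr
    exact (Matrix.abs_apply_le_l2_opNorm _ i i).trans hinv
  have e : R.looMatrix - R₀.looMatrix =
      R.looDiag * (R⁻¹ - R₀⁻¹) + (R.looDiag - R₀.looDiag) * R₀⁻¹ := by
    simp only [Matrix.looMatrix]; noncomm_ring
  rw [e]
  calc _ ≤ ‖R.looDiag‖ * ‖R⁻¹ - R₀⁻¹‖ + ‖R.looDiag - R₀.looDiag‖ * ‖R₀⁻¹‖ :=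
        (norm_add_le _ _).trans (add_le_add (norm_mul_le _ _) (norm_mul_le _ _))
    _ ≤ (u ^ 2 / l) * (1 / l ^ 2 * ‖R - R₀‖) +
        ((u ^ 2 / l) ^ 2 * (1 / l ^ 2 * ‖R - R₀‖)) * (1 / l) := by
        gcongr
        exacts [h.norm_looDiag_le hl hu, h₀.norm_inv_le hl]
    _ = _ := by field_simp

theorem looMatrix_mul (h : R.SpectrumIn l u) (hl : 0 < l) : R.looMatrix * R = R.looDiag := by
  rw [Matrix.looMatrix, mul_assoc, h.inv_mul hl, mul_one]

theorem looMatrix_apply_self (h : R.SpectrumIn l u) (hl : 0 < l) (hu : 0 < u) (i : m) :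
    R.looMatrix i i = 1 := by
  rw [Matrix.looMatrix, Matrix.looDiag, Matrix.diagonal_mul,
    inv_mul_cancel₀ (h.inv_apply_self_pos hl hu i).ne']

/-- If two correlation matrices have close leave-one-out residual matrices, they are close. -/
theorem frobSq_sub_le (h : R.SpectrumIn l u) (h₀ : R₀.SpectrumIn l u) (hl : 0 < l) (hu : 0 < u)
    (hd : ∀ i, R i i = 1) (hd₀ : ∀ i, R₀ i i = 1) :
    (R - R₀).frobSq ≤ 2 * (1 + u ^ 2) * (u ^ 2 / l) ^ 2 *
      (R.looMatrix - R₀.looMatrix).frobSq := by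
  set w : m → ℝ := fun i => R₀⁻¹ i i * (R⁻¹ i i)⁻¹ with hw
  set T : Matrix m m ℝ := Matrix.diagonal w with hT
  set D' : Matrix m m ℝ := Matrix.diagonal fun i => R₀⁻¹ i i with hD'
  have e1 : D' * R₀.looDiag = 1 := by
    rw [hD', Matrix.looDiag, Matrix.diagonal_mul_diagonal, ← Matrix.diagonal_one]
    congr 1; funext i
    exact mul_inv_cancel₀ (h₀.inv_apply_self_pos hl hu i).ne'
  have e2 : D' * R.looDiag = T := by
    rw [hD', Matrix.looDiag, Matrix.diagonal_mul_diagonal]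
  have e3 : R₀ * D' * (R₀.looMatrix - R.looMatrix) * R = R - R₀ * T := by
    rw [mul_sub, sub_mul, mul_assoc _ R.looMatrix, h.looMatrix_mul hl, mul_assoc R₀ D' R.looDiag,
      e2, Matrix.looMatrix, ← mul_assoc (R₀ * D'), mul_assoc R₀ D', e1, mul_one, h₀.mul_inv hl,
      one_mul]
  have hD'n : ‖D'‖ ≤ 1 / l := by
    refine Matrix.l2_opNorm_diagonal_le (by positivity) fun i => ?_
    rw [abs_of_pos (h₀.inv_apply_self_pos hl hu i)]
    exact h₀.inv_apply_self_le hl i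
  have b1 : (R - R₀ * T).frobSq ≤ (u ^ 2 / l) ^ 2 * (R.looMatrix - R₀.looMatrix).frobSq := by
    rw [← e3]
    have hs : (R₀.looMatrix - R.looMatrix).frobSq = (R.looMatrix - R₀.looMatrix).frobSq := by
      simp only [Matrix.frobSq, Matrix.sub_apply]
      exact Finset.sum_congr rfl fun i _ => Finset.sum_congr rfl fun j _ => by ring
    rw [← hs]
    calc _ ≤ ‖R‖ ^ 2 * (R₀ * D' * (R₀.looMatrix - R.looMatrix)).frobSq :=
          Matrix.frobSq_mul_le_right _ _
      _ ≤ ‖R‖ ^ 2 * (‖R₀ * D'‖ ^ 2 * (R₀.looMatrix - R.looMatrix).frobSq) := by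
          gcongr; exact Matrix.frobSq_mul_le_left _ _
      _ ≤ u ^ 2 * ((u * (1 / l)) ^ 2 * (R₀.looMatrix - R.looMatrix).frobSq) := by
          have hn : ‖R₀ * D'‖ ≤ u * (1 / l) := (norm_mul_le _ _).trans (by
            gcongr; exact h₀.upper)
          have := Matrix.frobSq_nonneg (R₀.looMatrix - R.looMatrix)
          gcongr
          exact h.upper
      _ = _ := by ring
  have b2 : (T - 1).frobSq ≤ (R - R₀ * T).frobSq := by
    refine Finset.sum_le_sum fun i _ => ?_
    have h1 : ∑ j, (T - 1) i j ^ 2 = (R - R₀ * T) i i ^ 2 := by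
      rw [Finset.sum_eq_single i]
      · simp [hT, Matrix.mul_diagonal, hd, hd₀]; ring
      · intro j _ hj; simp [hT, Matrix.diagonal_apply_ne _ hj.symm, Matrix.one_apply_ne hj.symm]
      · simp
    rw [h1]
    exact Finset.single_le_sum (f := fun j => (R - R₀ * T) i j ^ 2)
      (fun j _ => sq_nonneg _) (Finset.mem_univ i)
  have b3 : (R₀ * (T - 1)).frobSq ≤ u ^ 2 * (R - R₀ * T).frobSq :=
    (Matrix.frobSq_mul_le_left _ _).trans (mul_le_mul
      (pow_le_pow_left₀ (norm_nonneg _) h₀.upper 2) b2 (Matrix.frobSq_nonneg _) (sq_nonneg u))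
  have e4 : R - R₀ = (R - R₀ * T) + R₀ * (T - 1) := by rw [mul_sub, mul_one]; abel
  calc (R - R₀).frobSq ≤ 2 * (R - R₀ * T).frobSq + 2 * (R₀ * (T - 1)).frobSq := by
        rw [e4]; exact Matrix.frobSq_add_le _ _
    _ ≤ 2 * (1 + u ^ 2) * (R - R₀ * T).frobSq := by linarith
    _ ≤ 2 * (1 + u ^ 2) * ((u ^ 2 / l) ^ 2 * (R.looMatrix - R₀.looMatrix).frobSq) := by
        gcongr
    _ = _ := by ring

/-- The excess of the expected leave-one-out square error over its minimum. -/
theorem le_trace_looMatrix (h : R.SpectrumIn l u) (h₀ : R₀.SpectrumIn l u) (hl : 0 < l)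
    (hu : 0 < u) :
    l * (R.looMatrix - R₀.looMatrix).frobSq ≤
      ((R.looMatrixᵀ * R.looMatrix - R₀.looMatrixᵀ * R₀.looMatrix) * R₀).trace := by
  set A := R.looMatrix with hA
  set A₀ := R₀.looMatrix with hA₀
  set D := A - A₀ with hD
  have hDi : ∀ i, D i i = 0 := fun i => by
    rw [hD, Matrix.sub_apply, hA, hA₀, h.looMatrix_apply_self hl hu,
      h₀.looMatrix_apply_self hl hu, sub_self]
  have hcross : (D * R₀ * A₀ᵀ).trace = 0 := by
    have e : R₀ * A₀ᵀ = R₀.looDiag := by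
      have := congrArg Matrix.transpose (h₀.looMatrix_mul hl)
      rw [Matrix.transpose_mul, h₀.symm] at this
      rw [hA₀, this, Matrix.looDiag, Matrix.diagonal_transpose]
    rw [mul_assoc, e, Matrix.looDiag, Matrix.trace]
    exact Finset.sum_eq_zero fun i _ => by
      rw [Matrix.diag_apply, Matrix.mul_diagonal, hDi, zero_mul]
  have hcross' : (A₀ * R₀ * Dᵀ).trace = 0 := by
    rw [← Matrix.trace_transpose, Matrix.transpose_mul, Matrix.transpose_transpose,
      Matrix.transpose_mul, h₀.symm, ← mul_assoc, hcross]
  have e : ((Aᵀ * A - A₀ᵀ * A₀) * R₀).trace = (D * R₀ * Dᵀ).trace := by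
    have hAD : A = D + A₀ := by rw [hD]; abel
    rw [sub_mul, Matrix.trace_sub, mul_assoc, Matrix.trace_mul_comm, mul_assoc A₀ᵀ,
      Matrix.trace_mul_comm A₀ᵀ, hAD, Matrix.transpose_add, add_mul, add_mul, mul_add, mul_add,
      Matrix.trace_add, Matrix.trace_add, Matrix.trace_add, hcross, hcross']
    ring
  rw [e, Matrix.trace, Matrix.frobSq, Finset.mul_sum]
  refine Finset.sum_le_sum fun i _ => ?_
  have h1 := h₀.lower (D i)
  have h2 : (D * R₀ * Dᵀ).diag i = D i ⬝ᵥ R₀ *ᵥ D i := by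
    rw [Matrix.diag_apply, mul_assoc, Matrix.mul_apply]
    rfl
  rw [h2]
  refine le_trans (le_of_eq ?_) h1
  simp [dotProduct, sq]

/-- The leave-one-out residuals are given by the residual matrix. -/
theorem sub_krigingLOO {n : ℕ} {R : Matrix (Fin n) (Fin n) ℝ} (h : R.SpectrumIn l u)
    (hl : 0 < l) (hu : 0 < u) (y : Fin n → ℝ) (i : Fin n) :
    y i - krigingLOO R i (fun j => y j) = (R.looMatrix *ᵥ y) i := by
  classical
  set B := R.submatrix (fun j : {j // j ≠ i} => (j : Fin n)) (fun j : {j // j ≠ i} => (j : Fin n))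
    with hB
  have hBdet : IsUnit B.det :=
    ((h.posDef hl).submatrix Subtype.val_injective).det_pos.ne'.isUnit
  set A := R.looMatrix with hA
  have hrow : ∀ j, j ≠ i → R i j + ∑ k : {k // k ≠ i}, A i k * R k j = 0 := by
    intro j hj
    have h1 := congrFun (congrFun (h.looMatrix_mul hl) i) j
    rw [Matrix.mul_apply, Matrix.looDiag, Matrix.diagonal_apply_ne _ hj.symm,
      ← Finset.add_sum_erase _ _ (Finset.mem_univ i), h.looMatrix_apply_self hl hu,
      one_mul] at h1
    rw [← h1]
    congr 1
    exact (Finset.sum_subtype _ (fun k => by simp) (fun k => A i k * R k j)).symm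
  have hw : (fun k : {k // k ≠ i} => -A i k) ᵥ* B = fun j : {j // j ≠ i} => R i j := by
    funext j
    have := hrow j j.2
    simp only [Matrix.vecMul, dotProduct, hB, Matrix.submatrix_apply, neg_mul,
      Finset.sum_neg_distrib]
    linarith
  rw [krigingLOO, ← hw, ← hB, Matrix.dotProduct_mulVec, Matrix.vecMul_vecMul,
    Matrix.mul_nonsing_inv _ hBdet, Matrix.vecMul_one, Matrix.mulVec, dotProduct, dotProduct,
    ← Finset.add_sum_erase _ _ (Finset.mem_univ i),
    show A i i = 1 from h.looMatrix_apply_self hl hu i, one_mul]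
  have : ∑ k ∈ Finset.univ.erase i, A i k * y k = ∑ k : {k // k ≠ i}, A i k * y k :=
    Finset.sum_subtype _ (fun k => by simp) (fun k => A i k * y k)
  rw [this]
  simp

end Matrix.SpectrumIn

end MatrixEstimates

/-! ### Sums over separated point sets -/

/-- The points `s i` are at mutual distance at least `δ`. -/
def IsSeparatedFamily {ι E : Type*} [NormedAddCommGroup E] (δ : ℝ) (s : ι → E) : Prop :=
  ∀ i j, i ≠ j → δ ≤ ‖s i - s j‖

theorem exists_sum_separated_le (d : ℕ) {δ : ℝ} (hδ : 0 < δ) :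
    ∃ Λ : ℝ, 0 < Λ ∧ ∀ (n : ℕ) (s : Fin n → EuclideanSpace ℝ (Fin d)), IsSeparatedFamily δ s →
      ∀ x, ∑ j, 1 / (1 + ‖x - s j‖ ^ (d + 1)) ≤ Λ := by
  set F : EuclideanSpace ℝ (Fin d) → ℝ := fun t => ((1 + ‖t‖) ^ (d + 1))⁻¹ with hF
  have hFpos : ∀ t, 0 < F t := fun t => by simp only [hF]; positivity
  have hFint : Integrable F := by
    have := integrable_one_add_norm (E := EuclideanSpace ℝ (Fin d)) (μ := volume)
      (r := ((d + 1 : ℕ) : ℝ)) (by rw [finrank_euclideanSpace_fin]; push_cast; linarith)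
    refine this.congr (ae_of_all _ fun t => ?_)
    simp only [hF]
    rw [Real.rpow_neg (by positivity), Real.rpow_natCast]
  set b : ℝ := volume.real (Metric.ball (0 : EuclideanSpace ℝ (Fin d)) (δ / 2)) with hb
  have hbpos : 0 < b := by
    rw [hb, measureReal_def]
    exact ENNReal.toReal_pos (Metric.measure_ball_pos _ _ (by positivity)).ne'
      measure_ball_lt_top.ne
  set c : ℝ := (1 + δ / 2) ^ (d + 1) with hc
  have hcpos : 0 < c := by positivity
  have hIpos : 0 ≤ ∫ t, F t := integral_nonneg fun t => (hFpos t).le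
  refine ⟨2 ^ d * (c * (∫ t, F t) / b) + 1, by positivity, fun n s hs x => ?_⟩
  have hGint : Integrable fun t => F (x - t) := hFint.comp_sub_left x
  have key : ∀ j, b * F (x - s j) ≤ c * ∫ t in Metric.ball (s j) (δ / 2), F (x - t) := by
    intro j
    have h1 : ∫ _t in Metric.ball (s j) (δ / 2), F (x - s j) = b * F (x - s j) := by
      rw [setIntegral_const, smul_eq_mul, hb, measureReal_def, measureReal_def,
        Measure.addHaar_ball_center]
    rw [← h1, ← integral_const_mul]
    refine setIntegral_mono_on (integrableOn_const (by finiteness)) (hGint.const_mul c).integrableOn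
      measurableSet_ball fun t ht => ?_
    simp only [hF, hc]
    rw [← div_eq_mul_inv, ← one_div, div_le_div_iff₀ (by positivity) (by positivity), one_mul,
      ← mul_pow]
    refine pow_le_pow_left₀ (by positivity) ?_ _
    have h2 : ‖x - t‖ ≤ ‖x - s j‖ + δ / 2 := by
      have h3 : ‖t - s j‖ < δ / 2 := by rwa [← dist_eq_norm]
      have h4 : x - t = (x - s j) - (t - s j) := by abel
      rw [h4]
      exact (norm_sub_le _ _).trans (by linarith)
    nlinarith [norm_nonneg (x - s j)]
  have hdisj : Pairwise (Function.onFun Disjoint fun j => Metric.ball (s j) (δ / 2)) := by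
    intro i j hij
    refine Metric.ball_disjoint_ball ?_
    rw [dist_eq_norm]
    linarith [hs i j hij]
  have hsum : ∑ j, ∫ t in Metric.ball (s j) (δ / 2), F (x - t) ≤ ∫ t, F t := by
    rw [← integral_iUnion_fintype (fun j => measurableSet_ball) hdisj
      (fun j => hGint.integrableOn)]
    calc _ ≤ ∫ t, F (x - t) :=
          setIntegral_le_integral hGint (ae_of_all _ fun t => (hFpos _).le)
      _ = ∫ t, F t := integral_sub_left_eq_self F volume x
  have hF1 : ∀ t, 1 / (1 + ‖t‖ ^ (d + 1)) ≤ 2 ^ d * F t := by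
    intro t
    have := add_pow_le (zero_le_one (α := ℝ)) (norm_nonneg t) (d + 1)
    simp only [hF, one_pow, Nat.add_sub_cancel] at this ⊢
    rw [← div_eq_mul_inv, div_le_div_iff₀ (by positivity) (by positivity)]
    linarith
  have hmain : b * ∑ j, F (x - s j) ≤ c * ∫ t, F t := by
    rw [Finset.mul_sum]
    calc _ ≤ ∑ j, c * ∫ t in Metric.ball (s j) (δ / 2), F (x - t) :=
          Finset.sum_le_sum fun j _ => key j
      _ ≤ _ := by rw [← Finset.mul_sum]; gcongr
  calc _ ≤ ∑ j, 2 ^ d * F (x - s j) := Finset.sum_le_sum fun j _ => hF1 _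
    _ = 2 ^ d * ∑ j, F (x - s j) := by rw [Finset.mul_sum]
    _ ≤ 2 ^ d * (c * (∫ t, F t) / b) := by
        gcongr
        rw [le_div_iff₀ hbpos]; linarith
    _ ≤ _ := by linarith

/-! ### Lower bounds for quadratic forms of positive definite functions -/

section CosineTransform

variable {E : Type*} [NormedAddCommGroup E] [InnerProductSpace ℝ E]

/-- The squared modulus of the exponential sum `∑ c j exp (i f·s j)`. -/
noncomputable def expSumSq {n : ℕ} (s : Fin n → E) (c : Fin n → ℝ) (f : E) : ℝ :=
  (∑ i, c i * Real.cos (inner ℝ f (s i))) ^ 2 + (∑ i, c i * Real.sin (inner ℝ f (s i))) ^ 2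

theorem expSumSq_nonneg {n : ℕ} (s : Fin n → E) (c : Fin n → ℝ) (f : E) : 0 ≤ expSumSq s c f := by
  unfold expSumSq; positivity

theorem expSumSq_eq {n : ℕ} (s : Fin n → E) (c : Fin n → ℝ) (f : E) :
    expSumSq s c f = ∑ i, ∑ j, c i * c j * Real.cos (inner ℝ f (s i - s j)) := by
  simp only [expSumSq, sq, Finset.sum_mul_sum, ← Finset.sum_add_distrib, inner_sub_right,
    Real.cos_sub]
  exact Finset.sum_congr rfl fun i _ => Finset.sum_congr rfl fun j _ => by ring

variable [MeasurableSpace E] [BorelSpace E]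

theorem integrable_mul_cos_inner {μ : Measure E} {κ : E → ℝ} (hκ : Integrable κ μ) (t : E) :
    Integrable (fun f => κ f * Real.cos (inner ℝ f t)) μ := by
  refine hκ.mul_bdd (c := 1) ?_ (ae_of_all _ fun f => ?_)
  · exact (Real.continuous_cos.comp (by fun_prop)).aestronglyMeasurable
  · exact Real.abs_cos_le_one _

theorem integrable_mul_expSumSq {μ : Measure E} {κ : E → ℝ} (hκ : Integrable κ μ) {n : ℕ}
    (s : Fin n → E) (c : Fin n → ℝ) : Integrable (fun f => κ f * expSumSq s c f) μ := by
  simp only [expSumSq_eq, Finset.mul_sum]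
  refine integrable_finsetSum _ fun i _ => integrable_finsetSum _ fun j _ => ?_
  refine ((integrable_mul_cos_inner hκ (s i - s j)).const_mul (c i * c j)).congr
    (ae_of_all _ fun f => ?_)
  simp only; ring

theorem sum_sum_integral_mul_cos {μ : Measure E} {κ : E → ℝ} (hκ : Integrable κ μ) {n : ℕ}
    (s : Fin n → E) (c : Fin n → ℝ) :
    ∑ i, ∑ j, c i * c j * ∫ f, κ f * Real.cos (inner ℝ f (s i - s j)) ∂μ =
      ∫ f, κ f * expSumSq s c f ∂μ := by
  have h : ∀ i j, Integrable
      (fun f => c i * c j * (κ f * Real.cos (inner ℝ f (s i - s j)))) μ := fun i j =>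
    (integrable_mul_cos_inner hκ (s i - s j)).const_mul (c i * c j)
  simp only [← integral_const_mul]
  simp_rw [← integral_finsetSum _ fun j _ => h _ j]
  rw [← integral_finsetSum _ fun i _ => integrable_finsetSum _ fun j _ => h i j]
  refine integral_congr_ae (ae_of_all _ fun f => ?_)
  simp only [expSumSq_eq, Finset.mul_sum]
  exact Finset.sum_congr rfl fun i _ => Finset.sum_congr rfl fun j _ => by ring

end CosineTransform

/-- A nonnegative compactly supported function with rapidly decaying cosine transform. -/
theorem exists_bump_cosine_decay (d k : ℕ) :
    ∃ φ : EuclideanSpace ℝ (Fin d) → ℝ, Continuous φ ∧ Integrable φ ∧ (∀ f, 0 ≤ φ f) ∧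
      (∀ f, φ f ≤ 1) ∧ (∀ f, 1 < ‖f‖ → φ f = 0) ∧ 0 < ∫ f, φ f ∧
      ∃ C : ℝ, 0 < C ∧ ∀ t, ‖t‖ ^ k * |∫ f, φ f * Real.cos (inner ℝ f t)| ≤ C := by
  let B : ContDiffBump (0 : EuclideanSpace ℝ (Fin d)) := ⟨1 / 2, 1, by norm_num, by norm_num⟩
  have hBint : Integrable B := B.continuous.integrable_of_hasCompactSupport B.hasCompactSupport
  refine ⟨B, B.continuous, hBint, fun f => B.nonneg, fun f => B.le_one, fun f hf => ?_, ?_, ?_⟩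
  · exact B.zero_of_le_dist (by rw [dist_zero_right]; exact hf.le)
  · exact B.integral_pos
  · have hcd : ContDiff ℝ (⊤ : ℕ∞) (fun f => ((B f : ℝ) : ℂ)) :=
      Complex.ofRealCLM.contDiff.comp B.contDiff
    have hcs : HasCompactSupport (fun f => ((B f : ℝ) : ℂ)) :=
      B.hasCompactSupport.comp_left (g := fun x : ℝ => (x : ℂ)) Complex.ofReal_zero
    let S : SchwartzMap (EuclideanSpace ℝ (Fin d)) ℂ := hcs.toSchwartzMap hcd
    obtain ⟨C, hC, h⟩ := (FourierTransform.fourier S).decay k 0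
    refine ⟨(2 * Real.pi) ^ k * C, by positivity, fun t => ?_⟩
    have h1 := h ((2 * Real.pi)⁻¹ • t)
    rw [norm_iteratedFDeriv_zero, SchwartzMap.fourier_coe, Real.fourier_eq', norm_smul, mul_pow,
      norm_inv, Real.norm_of_nonneg (by positivity : 0 ≤ 2 * Real.pi)] at h1
    have e : ∀ f, Complex.exp ((↑(-2 * Real.pi * inner ℝ f ((2 * Real.pi)⁻¹ • t)) * Complex.I)) •
        S f = Complex.exp (((-inner ℝ f t : ℝ) : ℂ) * Complex.I) * ((B f : ℝ) : ℂ) := fun f => by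
      have : -2 * Real.pi * inner ℝ f ((2 * Real.pi)⁻¹ • t) = -inner ℝ f t := by
        rw [inner_smul_right]; field_simp
      rw [this, smul_eq_mul]
      rfl
    have hint : Integrable (fun f =>
        Complex.exp (((-inner ℝ f t : ℝ) : ℂ) * Complex.I) * ((B f : ℝ) : ℂ)) := by
      refine hBint.ofReal.bdd_mul (c := 1) ?_ (ae_of_all _ fun f => ?_)
      · exact (Continuous.cexp (by fun_prop)).aestronglyMeasurable
      · rw [Complex.norm_exp_ofReal_mul_I]
    have h2 : |∫ f, B f * Real.cos (inner ℝ f t)| ≤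
        ‖∫ f, Complex.exp (((-inner ℝ f t : ℝ) : ℂ) * Complex.I) * ((B f : ℝ) : ℂ)‖ := by
      refine le_trans (le_of_eq ?_) (Complex.abs_re_le_norm _)
      have hre := integral_re hint
      simp only [RCLike.re_eq_complex_re] at hre
      rw [← hre]
      congr 1
      refine integral_congr_ae (ae_of_all _ fun f => ?_)
      simp only [Complex.re_mul_ofReal, Complex.exp_ofReal_mul_I_re, Real.cos_neg]
      rw [mul_comm]
    simp_rw [e] at h1
    calc ‖t‖ ^ k * |∫ f, B f * Real.cos (inner ℝ f t)|
        ≤ ‖t‖ ^ k *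
          ‖∫ f, Complex.exp (((-inner ℝ f t : ℝ) : ℂ) * Complex.I) * ((B f : ℝ) : ℂ)‖ := by gcongr
      _ = (2 * Real.pi) ^ k * ((2 * Real.pi)⁻¹ ^ k * ‖t‖ ^ k *
          ‖∫ f, Complex.exp (((-inner ℝ f t : ℝ) : ℂ) * Complex.I) * ((B f : ℝ) : ℂ)‖) := by
          rw [inv_pow, ← mul_assoc, ← mul_assoc, mul_inv_cancel₀ (by positivity), one_mul]
      _ ≤ _ := by gcongr

theorem le_sum_sum_of_offdiag {n : ℕ} (H : Fin n → Fin n → ℝ) (hsymm : ∀ i j, H i j = H j i)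
    {h₀ η : ℝ} (hd : ∀ i, H i i = h₀) (hoff : ∀ i, ∑ j ∈ Finset.univ.erase i, |H i j| ≤ η)
    (c : Fin n → ℝ) : (h₀ - η) * ∑ i, c i ^ 2 ≤ ∑ i, ∑ j, c i * c j * H i j := by
  have h1 : ∀ i, ∑ j, c i * c j * H i j =
      h₀ * c i ^ 2 + ∑ j ∈ Finset.univ.erase i, c i * c j * H i j := fun i => by
    rw [← Finset.add_sum_erase _ _ (Finset.mem_univ i), hd]; ring
  have h2 : ∀ i, -(∑ j ∈ Finset.univ.erase i, |H i j| * (c i ^ 2 / 2)) -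
      ∑ j ∈ Finset.univ.erase i, |H i j| * (c j ^ 2 / 2) ≤
      ∑ j ∈ Finset.univ.erase i, c i * c j * H i j := by
    intro i
    rw [← Finset.sum_neg_distrib, ← Finset.sum_sub_distrib]
    refine Finset.sum_le_sum fun j _ => ?_
    have a1 : -(|c i| * |c j| * |H i j|) ≤ c i * c j * H i j := by
      rw [← abs_mul, ← abs_mul]; exact neg_abs_le _
    have a2 : (|c i| - |c j|) ^ 2 = c i ^ 2 - 2 * (|c i| * |c j|) + c j ^ 2 := by
      rw [← sq_abs (c i), ← sq_abs (c j)]; ring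
    have a3 := mul_nonneg (abs_nonneg (H i j)) (sq_nonneg (|c i| - |c j|))
    rw [a2] at a3
    linarith
  have h3 : ∑ i, ∑ j ∈ Finset.univ.erase i, |H i j| * (c j ^ 2 / 2) =
      ∑ i, ∑ j ∈ Finset.univ.erase i, |H i j| * (c i ^ 2 / 2) := by
    rw [Finset.sum_comm' (t' := Finset.univ) (s' := fun j => Finset.univ.erase j)
      (by intro x y; simp [ne_comm])]
    refine Finset.sum_congr rfl fun i _ => Finset.sum_congr rfl fun j _ => by rw [hsymm]
  have h4 : ∑ i, ∑ j ∈ Finset.univ.erase i, |H i j| * (c i ^ 2 / 2) ≤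
      ∑ i, η * (c i ^ 2 / 2) := by
    refine Finset.sum_le_sum fun i _ => ?_
    rw [← Finset.sum_mul]
    exact mul_le_mul_of_nonneg_right (hoff i) (by positivity)
  have h5 := Finset.sum_le_sum fun i (_ : i ∈ Finset.univ) => h2 i
  simp only [h1, Finset.sum_add_distrib, Finset.sum_sub_distrib, Finset.sum_neg_distrib, h3]
    at h5 ⊢
  rw [← Finset.mul_sum, ← Finset.sum_div] at h4
  rw [← Finset.mul_sum]
  linarith

/-- The quadratic form of a positive definite function with spectral density `κ` at `δ`-separated
points is bounded below in terms of a lower bound of `κ` on a large ball. -/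
theorem exists_le_quadratic_form (d : ℕ) {δ : ℝ} (hδ : 0 < δ) :
    ∃ M : ℝ, 0 < M ∧ ∃ A : ℝ, 0 < A ∧ ∀ (κ : EuclideanSpace ℝ (Fin d) → ℝ) (m : ℝ),
      Integrable κ → 0 ≤ m → (∀ f, 0 ≤ κ f) → (∀ f, ‖f‖ ≤ M → m ≤ κ f) →
      ∀ (n : ℕ) (s : Fin n → EuclideanSpace ℝ (Fin d)), IsSeparatedFamily δ s →
        ∀ c : Fin n → ℝ, m * A * ∑ i, c i ^ 2 ≤
          ∑ i, ∑ j, c i * c j * ∫ f, κ f * Real.cos (inner ℝ f (s i - s j)) := by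
  obtain ⟨Λ, hΛ, hsum⟩ := exists_sum_separated_le d hδ
  obtain ⟨φ, hφc, hφi, hφ0, hφ1, hφs, hφpos, C, hC, hdecay⟩ := exists_bump_cosine_decay d (d + 1)
  set h : EuclideanSpace ℝ (Fin d) → ℝ := fun t => ∫ f, φ f * Real.cos (inner ℝ f t) with hh
  have hh0 : h 0 = ∫ f, φ f := by simp [hh]
  have hneg : ∀ t, h (-t) = h t := fun t => by simp [hh, inner_neg_right]
  set C' : ℝ := C * (1 + (δ ^ (d + 1))⁻¹) * Λ with hC'
  have hC'pos : 0 < C' := by positivity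
  set M : ℝ := max 1 (2 * C' / h 0) with hM
  have hM1 : 1 ≤ M := le_max_left _ _
  have hM0 : 0 < M := lt_of_lt_of_le one_pos hM1
  have hh0pos : 0 < h 0 := by rw [hh0]; exact hφpos
  have hoff : ∀ (n : ℕ) (s : Fin n → EuclideanSpace ℝ (Fin d)), IsSeparatedFamily δ s → ∀ i,
      ∑ j ∈ Finset.univ.erase i, |h (M • (s i - s j))| ≤ h 0 / 2 := by
    intro n s hs i
    have h1 : ∀ j ∈ Finset.univ.erase i, |h (M • (s i - s j))| ≤
        C * (1 + (δ ^ (d + 1))⁻¹) / M * (1 / (1 + ‖s i - s j‖ ^ (d + 1))) := by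
      intro j hj
      have hij : δ ≤ ‖s i - s j‖ := hs i j (Finset.ne_of_mem_erase hj).symm
      set r := ‖s i - s j‖ with hr
      have h2 := hdecay (M • (s i - s j))
      rw [norm_smul, Real.norm_of_nonneg hM0.le, mul_pow] at h2
      have hr0 : 0 < r := hδ.trans_le hij
      have h3 : M ≤ M ^ (d + 1) := le_self_pow₀ hM1 (by omega)
      have h4 : 1 + r ^ (d + 1) ≤ (1 + (δ ^ (d + 1))⁻¹) * r ^ (d + 1) := by
        have : 1 ≤ (δ ^ (d + 1))⁻¹ * r ^ (d + 1) := by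
          rw [← div_eq_inv_mul, one_le_div (by positivity)]
          exact pow_le_pow_left₀ hδ.le hij _
        linarith
      rw [div_mul_div_comm, mul_one, le_div_iff₀ (by positivity)]
      set a := |h (M • (s i - s j))| with ha
      have ha0 : 0 ≤ a := abs_nonneg _
      calc a * (M * (1 + r ^ (d + 1)))
          ≤ a * (M ^ (d + 1) * ((1 + (δ ^ (d + 1))⁻¹) * r ^ (d + 1))) := by gcongr
        _ = (1 + (δ ^ (d + 1))⁻¹) * (M ^ (d + 1) * r ^ (d + 1) * a) := by ring
        _ ≤ (1 + (δ ^ (d + 1))⁻¹) * C := by gcongr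
        _ = _ := by ring
    calc _ ≤ ∑ j ∈ Finset.univ.erase i,
          C * (1 + (δ ^ (d + 1))⁻¹) / M * (1 / (1 + ‖s i - s j‖ ^ (d + 1))) :=
          Finset.sum_le_sum h1
      _ ≤ ∑ j, C * (1 + (δ ^ (d + 1))⁻¹) / M * (1 / (1 + ‖s i - s j‖ ^ (d + 1))) :=
          Finset.sum_le_sum_of_subset_of_nonneg (Finset.erase_subset _ _)
            fun j _ _ => by positivity
      _ ≤ C * (1 + (δ ^ (d + 1))⁻¹) / M * Λ := by
          rw [← Finset.mul_sum]
          gcongr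
          exact hsum n s hs (s i)
      _ = C' / M := by rw [hC']; ring
      _ ≤ h 0 / 2 := by
          rw [div_le_div_iff₀ hM0 two_pos]
          have := le_max_right 1 (2 * C' / h 0)
          rw [← hM, div_le_iff₀ hh0pos] at this
          linarith
  refine ⟨M, hM0, M ^ d * (h 0 / 2), by positivity, fun κ m hκ hm hκ0 hκm n s hs c => ?_⟩
  rw [sum_sum_integral_mul_cos hκ]
  have hscale : ∀ t, ∫ f, φ (M⁻¹ • f) * Real.cos (inner ℝ f t) = M ^ d * h (M • t) := by
    intro t
    have := Measure.integral_comp_inv_smul_of_nonneg volume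
      (fun f : EuclideanSpace ℝ (Fin d) => φ f * Real.cos (inner ℝ f (M • t))) hM0.le
    rw [finrank_euclideanSpace_fin, smul_eq_mul] at this
    rw [hh, ← this]
    refine integral_congr_ae (ae_of_all _ fun f => ?_)
    simp only [inner_smul_left, inner_smul_right, RCLike.conj_to_real]
    rw [← mul_assoc, mul_inv_cancel₀ hM0.ne', one_mul]
  have hφMi : Integrable fun f : EuclideanSpace ℝ (Fin d) => φ (M⁻¹ • f) :=
    hφi.comp_smul (inv_ne_zero hM0.ne')
  have hlow : M ^ d * (h 0 / 2) * ∑ i, c i ^ 2 ≤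
      ∫ f, φ (M⁻¹ • f) * expSumSq s c f := by
    rw [← sum_sum_integral_mul_cos hφMi]
    simp only [hscale]
    have := le_sum_sum_of_offdiag (fun i j => h (M • (s i - s j)))
      (fun i j => by rw [← hneg, ← smul_neg, neg_sub]) (h₀ := h 0) (by simp) (hoff n s hs) c
    calc _ = M ^ d * ((h 0 - h 0 / 2) * ∑ i, c i ^ 2) := by ring
      _ ≤ M ^ d * ∑ i, ∑ j, c i * c j * h (M • (s i - s j)) := by gcongr
      _ = _ := by
        rw [Finset.mul_sum]
        refine Finset.sum_congr rfl fun i _ => ?_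
        rw [Finset.mul_sum]
        exact Finset.sum_congr rfl fun j _ => by ring
  calc _ = m * (M ^ d * (h 0 / 2) * ∑ i, c i ^ 2) := by ring
    _ ≤ m * ∫ f, φ (M⁻¹ • f) * expSumSq s c f := by gcongr
    _ = ∫ f, m * (φ (M⁻¹ • f) * expSumSq s c f) := by rw [integral_const_mul]
    _ ≤ _ := by
      refine integral_mono ((integrable_mul_expSumSq hφMi s c).const_mul m)
        (integrable_mul_expSumSq hκ s c) fun f => ?_
      simp only
      rw [← mul_assoc]
      refine mul_le_mul_of_nonneg_right ?_ (expSumSq_nonneg s c f)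
      by_cases hf : ‖f‖ ≤ M
      · calc m * φ (M⁻¹ • f) ≤ m * 1 := by gcongr; exact hφ1 _
          _ ≤ κ f := by rw [mul_one]; exact hκm f hf
      · rw [hφs, mul_zero]
        · exact hκ0 f
        · rw [norm_smul, norm_inv, Real.norm_of_nonneg hM0.le, ← div_eq_inv_mul,
            lt_div_iff₀ hM0]
          linarith

/-! ### Consequences of the regularity of the covariance model -/

section Model

variable {d p : ℕ} {a b : ℝ} {K : (Fin p → ℝ) → EuclideanSpace ℝ (Fin d) → ℝ}

theorem paramCube_eq_pi (p : ℕ) (a b : ℝ) :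
    paramCube p a b = Set.pi Set.univ fun _ => Set.Icc a b := by
  ext θ; simp only [paramCube, Set.mem_ofPred_eq, Set.mem_univ_pi]

theorem isCompact_paramCube (p : ℕ) (a b : ℝ) : IsCompact (paramCube p a b) := by
  rw [paramCube_eq_pi]; exact isCompact_univ_pi fun _ => isCompact_Icc

theorem convex_paramCube (p : ℕ) (a b : ℝ) : Convex ℝ (paramCube p a b) := by
  rw [paramCube_eq_pi]; exact convex_pi fun _ _ => convex_Icc a b

theorem uniqueDiffOn_paramCube (hab : Fin p → a < b) :
    UniqueDiffOn ℝ (paramCube p a b) := by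
  rw [paramCube_eq_pi]; exact UniqueDiffOn.univ_pi fun i => uniqueDiffOn_Icc (hab i)

theorem opNorm_le_sum_single (T : (Fin p → ℝ) →L[ℝ] ℝ) :
    ‖T‖ ≤ ∑ i, |T (Pi.single i 1)| := by
  refine T.opNorm_le_bound (Finset.sum_nonneg fun i _ => abs_nonneg _) fun x => ?_
  have hx : T x = ∑ i, x i * T (Pi.single i 1) := by
    conv_lhs => rw [pi_eq_sum_univ' x, map_sum]
    simp [map_smul]
  rw [hx, Finset.sum_mul]
  refine (norm_sum_le _ _).trans (Finset.sum_le_sum fun i _ => ?_)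
  rw [norm_mul, mul_comm, Real.norm_eq_abs]
  gcongr
  exact norm_le_pi_norm x i

namespace IsRegularCovarianceModel

theorem exists_abs_le (hK : IsRegularCovarianceModel a b K) :
    ∃ C : ℝ, 0 < C ∧ ∀ θ ∈ paramCube p a b, ∀ t, |K θ t| ≤ C * (1 / (1 + ‖t‖ ^ (d + 1))) := by
  obtain ⟨C, hC⟩ := hK.bound 0 (by norm_num) Fin.elim0
  refine ⟨max C 1, by positivity, fun θ hθ t => ?_⟩
  have h := hC θ hθ t
  rw [iteratedFDerivWithin_zero_apply] at h
  refine h.trans ?_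
  rw [mul_one_div]
  gcongr
  exact le_max_left _ _

theorem exists_lipschitz (hK : IsRegularCovarianceModel a b K) (hab : Fin p → a < b) :
    ∃ C : ℝ, 0 < C ∧ ∀ θ ∈ paramCube p a b, ∀ θ' ∈ paramCube p a b, ∀ t,
      |K θ t - K θ' t| ≤ C * ‖θ - θ'‖ * (1 / (1 + ‖t‖ ^ (d + 1))) := by
  have hC := fun i : Fin p => hK.bound 1 (by norm_num) (fun _ => i)
  choose C hC using hC
  have hC0 : 0 ≤ ∑ i, |C i| := Finset.sum_nonneg fun i _ => abs_nonneg _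
  refine ⟨∑ i, |C i| + 1, by positivity, fun θ hθ θ' hθ' t => ?_⟩
  have hdiff : DifferentiableOn ℝ (fun θ => K θ t) (paramCube p a b) := by
    have h := hK.differentiable t 0 (by norm_num)
    rw [iteratedFDerivWithin_zero_eq_comp] at h
    exact (LinearIsometryEquiv.comp_differentiableOn_iff _).1 h
  have hbd : ∀ x ∈ paramCube p a b, ‖fderivWithin ℝ (fun θ => K θ t) (paramCube p a b) x‖ ≤
      (∑ i, |C i| + 1) * (1 / (1 + ‖t‖ ^ (d + 1))) := by
    intro x hx
    refine (opNorm_le_sum_single _).trans ?_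
    have h1 : ∀ i, |fderivWithin ℝ (fun θ => K θ t) (paramCube p a b) x (Pi.single i 1)| ≤
        |C i| * (1 / (1 + ‖t‖ ^ (d + 1))) := by
      intro i
      have h2 := hC i x hx t
      rw [iteratedFDerivWithin_one_apply (uniqueDiffOn_paramCube hab x hx)] at h2
      refine h2.trans ?_
      rw [mul_one_div]
      gcongr
      exact le_abs_self _
    refine (Finset.sum_le_sum fun i _ => h1 i).trans ?_
    rw [← Finset.sum_mul]
    gcongr
    linarith
  have := (convex_paramCube p a b).norm_image_sub_le_of_norm_fderivWithin_le hdiff hbd hθ' hθ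
  rw [Real.norm_eq_abs] at this
  refine this.trans (le_of_eq (by ring))

theorem integrable_re_hat (hK : IsRegularCovarianceModel a b K) {θ : Fin p → ℝ}
    (hθ : θ ∈ paramCube p a b) : Integrable fun f => (fourierHat (K θ) f).re :=
  (hK.integrable_hat θ hθ).re

theorem eq_integral_cos (hK : IsRegularCovarianceModel a b K) {θ : Fin p → ℝ}
    (hθ : θ ∈ paramCube p a b) (t : EuclideanSpace ℝ (Fin d)) :
    K θ t = ∫ f, (fourierHat (K θ) f).re * Real.cos (inner ℝ f t) := by
  have hint : Integrable (fun f =>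
      fourierHat (K θ) f * Complex.exp (Complex.I * ((inner ℝ f t : ℝ) : ℂ))) := by
    refine (hK.integrable_hat θ hθ).mul_bdd (c := 1) ?_ (ae_of_all _ fun f => ?_)
    · exact (Continuous.cexp (by fun_prop)).aestronglyMeasurable
    · rw [mul_comm, Complex.norm_exp_ofReal_mul_I]
  have h := congrArg Complex.re (hK.inversion θ hθ t)
  have hre := integral_re hint
  simp only [RCLike.re_eq_complex_re] at hre
  rw [← hre, Complex.ofReal_re] at h
  rw [h]
  refine integral_congr_ae (ae_of_all _ fun f => ?_)
  simp only
  rw [Complex.mul_re, (hK.hat_pos θ hθ f).2, zero_mul, sub_zero, mul_comm Complex.I,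
    Complex.exp_ofReal_mul_I_re]

theorem continuous (hK : IsRegularCovarianceModel a b K) {θ : Fin p → ℝ}
    (hθ : θ ∈ paramCube p a b) : Continuous (K θ) := by
  rw [show K θ = _ from funext (hK.eq_integral_cos hθ)]
  refine continuous_of_dominated (bound := fun f => |(fourierHat (K θ) f).re|)
    (fun t => (integrable_mul_cos_inner (hK.integrable_re_hat hθ) t).aestronglyMeasurable)
    (fun t => ae_of_all _ fun f => ?_) (hK.integrable_re_hat hθ).abs
    (ae_of_all _ fun f => by fun_prop)
  rw [norm_mul]
  exact mul_le_of_le_one_right (norm_nonneg _) (Real.abs_cos_le_one _)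

theorem exists_le_hat (hK : IsRegularCovarianceModel a b K) (M : ℝ) :
    ∃ m : ℝ, 0 < m ∧ ∀ θ ∈ paramCube p a b, ∀ f, ‖f‖ ≤ M → m ≤ (fourierHat (K θ) f).re := by
  have hcomp : IsCompact
      (Metric.closedBall (0 : EuclideanSpace ℝ (Fin d)) M ×ˢ paramCube p a b) :=
    (isCompact_closedBall _ _).prod (isCompact_paramCube p a b)
  have hcont : ContinuousOn
      (fun x : EuclideanSpace ℝ (Fin d) × (Fin p → ℝ) => (fourierHat (K x.2) x.1).re)
      (Metric.closedBall (0 : EuclideanSpace ℝ (Fin d)) M ×ˢ paramCube p a b) :=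
    Complex.continuous_re.comp_continuousOn
      (hK.hat_continuous.mono (Set.prod_mono (Set.subset_univ _) subset_rfl))
  obtain ⟨m, hm, h⟩ := hcomp.exists_forall_le' hcont (a := 0)
    fun x hx => (hK.hat_pos x.2 hx.2 x.1).1
  exact ⟨m, hm, fun θ hθ f hf => h (f, θ) ⟨by simpa using hf, hθ⟩⟩

theorem transpose_covMatrix (hK : IsRegularCovarianceModel a b K) {θ : Fin p → ℝ}
    (hθ : θ ∈ paramCube p a b) {n : ℕ} (s : Fin n → EuclideanSpace ℝ (Fin d)) :
    (covMatrix (K θ) s)ᵀ = covMatrix (K θ) s := by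
  ext i j
  simp only [covMatrix, Matrix.transpose_apply, Matrix.of_apply]
  rw [← (hK.stationary θ hθ).1, neg_sub]

open scoped Matrix.Norms.L2Operator

theorem exists_spectrumIn (hK : IsRegularCovarianceModel a b K) {δ : ℝ} (hδ : 0 < δ) :
    ∃ l u : ℝ, 0 < l ∧ 0 < u ∧ ∀ θ ∈ paramCube p a b, ∀ (n : ℕ)
      (s : Fin n → EuclideanSpace ℝ (Fin d)), IsSeparatedFamily δ s →
        (covMatrix (K θ) s).SpectrumIn l u := by
  obtain ⟨M, hM, A, hA, hquad⟩ := exists_le_quadratic_form d hδ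
  obtain ⟨m, hm, hmK⟩ := hK.exists_le_hat M
  obtain ⟨Λ, hΛ, hsum⟩ := exists_sum_separated_le d hδ
  obtain ⟨C, hC, hKC⟩ := hK.exists_abs_le
  refine ⟨m * A, C * Λ, by positivity, by positivity, fun θ hθ n s hs =>
    ⟨hK.transpose_covMatrix hθ s, fun x => ?_, ?_⟩⟩
  · have h := hquad _ m (hK.integrable_re_hat hθ) hm.le (fun f => (hK.hat_pos θ hθ f).1.le)
      (hmK θ hθ) n s hs x
    simp only [← hK.eq_integral_cos hθ] at h
    refine (le_of_eq ?_).trans (h.trans (le_of_eq ?_))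
    · simp [dotProduct, sq]
    · simp only [dotProduct, Matrix.mulVec, covMatrix, Matrix.of_apply, Finset.mul_sum]
      exact Finset.sum_congr rfl fun i _ => Finset.sum_congr rfl fun j _ => by ring
  · refine Matrix.l2_opNorm_le_of_row_sum (hK.transpose_covMatrix hθ s) (by positivity)
      fun i => ?_
    calc _ ≤ ∑ j, C * (1 / (1 + ‖s i - s j‖ ^ (d + 1))) :=
          Finset.sum_le_sum fun j _ => hKC θ hθ _
      _ ≤ C * Λ := by rw [← Finset.mul_sum]; gcongr; exact hsum n s hs (s i)

theorem exists_covMatrix_lipschitz (hK : IsRegularCovarianceModel a b K) (hab : Fin p → a < b)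
    {δ : ℝ} (hδ : 0 < δ) :
    ∃ C : ℝ, 0 < C ∧ ∀ θ ∈ paramCube p a b, ∀ θ' ∈ paramCube p a b, ∀ (n : ℕ)
      (s : Fin n → EuclideanSpace ℝ (Fin d)), IsSeparatedFamily δ s →
        ‖covMatrix (K θ) s - covMatrix (K θ') s‖ ≤ C * ‖θ - θ'‖ := by
  obtain ⟨Λ, hΛ, hsum⟩ := exists_sum_separated_le d hδ
  obtain ⟨C, hC, hKC⟩ := hK.exists_lipschitz hab
  refine ⟨C * Λ, by positivity, fun θ hθ θ' hθ' n s hs => ?_⟩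
  refine Matrix.l2_opNorm_le_of_row_sum ?_ (by positivity) fun i => ?_
  · rw [Matrix.transpose_sub, hK.transpose_covMatrix hθ, hK.transpose_covMatrix hθ']
  · calc _ ≤ ∑ j, C * ‖θ - θ'‖ * (1 / (1 + ‖s i - s j‖ ^ (d + 1))) :=
          Finset.sum_le_sum fun j _ => hKC θ hθ θ' hθ' _
      _ ≤ C * ‖θ - θ'‖ * Λ := by rw [← Finset.mul_sum]; gcongr; exact hsum n s hs (s i)
      _ = _ := by ring

end IsRegularCovarianceModel

end Model

/-! ### Concentration of Gaussian quadratic forms -/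

section Whitening

variable {m : Type*} [Fintype m] [DecidableEq m]

open scoped MatrixOrder in
theorem Matrix.PosSemidef.exists_eq_transpose_mul_self {R : Matrix m m ℝ} (hR : R.PosSemidef) :
    ∃ S : Matrix m m ℝ, R = Sᵀ * S := by
  obtain ⟨S, hS⟩ := CStarAlgebra.nonneg_iff_eq_star_mul_self.mp hR.nonneg
  exact ⟨S, by rw [hS, Matrix.star_eq_conjTranspose,
    Matrix.conjTranspose_eq_transpose_of_trivial]⟩

open scoped Matrix.Norms.L2Operator

/-- Simultaneous reduction of a covariance matrix to the identity and of a quadratic form to a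
diagonal one. -/
theorem Matrix.SpectrumIn.exists_whitening {R B : Matrix m m ℝ} {l u : ℝ}
    (hR : R.SpectrumIn l u) (hl : 0 < l) (hB : Bᵀ = B) :
    ∃ (Q : Matrix m m ℝ) (v : m → ℝ), IsUnit Q.det ∧ Q * Qᵀ = R ∧
      Qᵀ * B * Q = Matrix.diagonal v ∧ ∀ i, |v i| ≤ u * ‖B‖ := by
  obtain ⟨S, hS⟩ := (hR.posDef hl).posSemidef.exists_eq_transpose_mul_self
  have hSdet : S.det ≠ 0 := by
    intro h0
    have := (hR.posDef hl).det_pos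
    rw [hS, Matrix.det_mul, h0, mul_zero] at this
    exact this.false
  set N := S * B * Sᵀ with hN
  have hNh : N.IsHermitian := by
    rw [Matrix.IsHermitian, Matrix.conjTranspose_eq_transpose_of_trivial, hN,
      Matrix.transpose_mul, Matrix.transpose_mul, Matrix.transpose_transpose, hB, ← mul_assoc]
  set U := hNh.eigenvectorUnitary with hU
  set W : Matrix m m ℝ := (U : Matrix m m ℝ) with hW
  have hstar : star W = Wᵀ := by
    rw [Matrix.star_eq_conjTranspose, Matrix.conjTranspose_eq_transpose_of_trivial]
  have hWW : W * Wᵀ = 1 := by rw [← hstar]; exact Unitary.coe_mul_star_self U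
  have hdiag : Wᵀ * N * W = Matrix.diagonal hNh.eigenvalues := by
    have := hNh.conjStarAlgAut_star_eigenvectorUnitary
    rw [Unitary.conjStarAlgAut_star_apply] at this
    rw [← hstar]
    exact this
  have hNn : ‖N‖ ≤ u * ‖B‖ := by
    have h1 : ‖S‖ * ‖S‖ ≤ u := by
      rw [← Matrix.l2_opNorm_conjTranspose_mul_self,
        Matrix.conjTranspose_eq_transpose_of_trivial, ← hS]
      exact hR.upper
    calc ‖N‖ ≤ ‖S‖ * ‖B‖ * ‖Sᵀ‖ :=
          (norm_mul_le _ _).trans (by gcongr; exact norm_mul_le _ _)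
      _ = ‖S‖ * ‖S‖ * ‖B‖ := by rw [Matrix.l2_opNorm_transpose]; ring
      _ ≤ u * ‖B‖ := by gcongr
  refine ⟨Sᵀ * W, hNh.eigenvalues, ?_, ?_, ?_, fun i => ?_⟩
  · rw [Matrix.det_mul, Matrix.det_transpose]
    refine (mul_ne_zero hSdet fun h0 => ?_).isUnit
    have := congrArg Matrix.det hWW
    rw [Matrix.det_mul, h0, zero_mul, Matrix.det_one] at this
    exact zero_ne_one this
  · rw [Matrix.transpose_mul, Matrix.transpose_transpose, mul_assoc, ← mul_assoc W, hWW, one_mul,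
      hS]
  · rw [← hdiag, hN, Matrix.transpose_mul, Matrix.transpose_transpose]
    simp only [mul_assoc]
  · have h1 := Matrix.abs_apply_le_l2_opNorm (Matrix.diagonal hNh.eigenvalues) i i
    rw [Matrix.diagonal_apply_eq, ← hdiag, ← hstar] at h1
    refine h1.trans ?_
    rw [hW, CStarRing.norm_mul_coe_unitary, ← Unitary.coe_star, CStarRing.norm_coe_unitary_mul]
    exact hNn

end Whitening

/-- The variance of the square of a standard Gaussian variable. -/
noncomputable def gaussianSqVariance : ℝ := Var[fun x : ℝ => x ^ 2; gaussianReal 0 1]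

section GaussianConcentration

open scoped Matrix.Norms.L2Operator

variable {Ω : Type*} [MeasurableSpace Ω] {P : Measure Ω}

theorem ProbabilityTheory.HasGaussianLaw.memLp_sq {Z : Ω → ℝ} (hZ : HasGaussianLaw Z P) :
    MemLp (fun ω => Z ω ^ 2) 2 P := by
  rw [memLp_two_iff_integrable_sq (hZ.aemeasurable.pow_const 2).aestronglyMeasurable]
  have h : MemLp Z (4 : ℕ) P := hZ.memLp (by norm_num)
  refine (h.integrable_norm_pow (by norm_num)).congr (ae_of_all _ fun ω => ?_)
  simp only [Real.norm_eq_abs]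
  rw [← pow_mul, ← abs_pow, abs_of_nonneg (by positivity)]

/-- Chebyshev's inequality for quadratic forms in a centered Gaussian vector. -/
theorem measure_gaussian_quadratic_form_le [IsProbabilityMeasure P] {n : ℕ} {y : Fin n → Ω → ℝ}
    (hy : HasGaussianLaw (fun ω i => y i ω) P) (hy0 : ∀ i, ∫ ω, y i ω ∂P = 0)
    {R B : Matrix (Fin n) (Fin n) ℝ} {l u : ℝ} (hR : R.SpectrumIn l u) (hl : 0 < l)
    (hcov : ∀ i j, cov[y i, y j; P] = R i j) (hB : Bᵀ = B) {t : ℝ} (ht : 0 < t) :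
    P {ω | t ≤ |(fun i => y i ω) ⬝ᵥ B *ᵥ (fun i => y i ω) - (B * R).trace|} ≤
      ENNReal.ofReal (n * ((u * ‖B‖) ^ 2 * gaussianSqVariance) / t ^ 2) := by
  obtain ⟨Q, v, hQ, hQR, hQB, hv⟩ := hR.exists_whitening hl hB
  set z : Fin n → Ω → ℝ := fun i ω => ∑ j, Q⁻¹ i j * y j ω with hz
  have hzy : ∀ ω, (fun i => z i ω) = Q⁻¹ *ᵥ fun i => y i ω := fun ω => rfl
  have hyz : ∀ ω, (fun i => y i ω) = Q *ᵥ fun i => z i ω := fun ω => by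
    rw [hzy, Matrix.mulVec_mulVec, Matrix.mul_nonsing_inv _ hQ, Matrix.one_mulVec]
  have hzG : HasGaussianLaw (fun ω i => z i ω) P :=
    hy.map_fun (Matrix.mulVecLin Q⁻¹).toContinuousLinearMap
  have hyL : ∀ i, MemLp (y i) 2 P := fun i => (hy.eval i).memLp_two
  have hz0 : ∀ i, ∫ ω, z i ω ∂P = 0 := fun i => by
    rw [hz, integral_finsetSum _ fun j _ => ((hy.eval j).integrable).const_mul _]
    simp [integral_const_mul, hy0]
  have hzcov : ∀ i j, cov[z i, z j; P] = (1 : Matrix (Fin n) (Fin n) ℝ) i j := by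
    intro i j
    have h1 : Q⁻¹ * R * (Q⁻¹)ᵀ = 1 := by
      rw [← hQR, ← mul_assoc, Matrix.nonsing_inv_mul _ hQ, one_mul, ← Matrix.transpose_mul,
        Matrix.nonsing_inv_mul _ hQ, Matrix.transpose_one]
    rw [hz, covariance_fun_sum_fun_sum (fun k => (hyL k).const_mul _)
      (fun k => (hyL k).const_mul _), ← h1]
    simp only [covariance_const_mul_left, covariance_const_mul_right, hcov, Matrix.mul_apply,
      Matrix.transpose_apply, Finset.sum_mul]
    rw [Finset.sum_comm]
    exact Finset.sum_congr rfl fun _ _ => Finset.sum_congr rfl fun _ _ => by ring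
  have hindep : iIndepFun z P :=
    hzG.iIndepFun_of_covariance_eq_zero fun i j hij => by rw [hzcov, Matrix.one_apply_ne hij]
  have hzv : ∀ i, Var[z i; P] = 1 := fun i => by
    rw [← covariance_self (hzG.eval i).aemeasurable, hzcov, Matrix.one_apply_eq]
  have hzlaw : ∀ i, P.map (z i) = gaussianReal 0 1 := fun i => by
    rw [(hzG.eval i).map_eq_gaussianReal, hz0, hzv]; simp
  have hzsq : ∀ i, MemLp (fun ω => z i ω ^ 2) 2 P := fun i => (hzG.eval i).memLp_sq
  have hvar : ∀ i, Var[fun ω => z i ω ^ 2; P] = gaussianSqVariance := fun i => by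
    rw [gaussianSqVariance, ← hzlaw i, variance_map (by fun_prop) (hzG.eval i).aemeasurable]
    rfl
  have hmean : ∀ i, ∫ ω, z i ω ^ 2 ∂P = 1 := fun i => by
    rw [← variance_of_integral_eq_zero (hzG.eval i).aemeasurable (hz0 i), hzv]
  set q : Ω → ℝ := fun ω => ∑ i, v i * z i ω ^ 2 with hq
  have hqy : ∀ ω, (fun i => y i ω) ⬝ᵥ B *ᵥ (fun i => y i ω) = q ω := by
    intro ω
    rw [hyz ω, Matrix.mulVec_mulVec, Matrix.dotProduct_mulVec, Matrix.vecMul_mulVec,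
      ← Matrix.dotProduct_mulVec, ← mul_assoc, hQB]
    simp only [hq, dotProduct, Matrix.mulVec_diagonal]
    exact Finset.sum_congr rfl fun i _ => by ring
  have htr : (B * R).trace = ∫ ω, q ω ∂P := by
    rw [hq, integral_finsetSum _ fun i _ => ((hzsq i).integrable one_le_two).const_mul _]
    simp only [integral_const_mul, hmean, mul_one]
    rw [← hQR, ← mul_assoc, Matrix.trace_mul_comm, ← mul_assoc, hQB, Matrix.trace_diagonal]
  have hqL : MemLp q 2 P := memLp_finsetSum _ fun i _ => (hzsq i).const_mul _
  have hqvar : Var[q; P] ≤ n * ((u * ‖B‖) ^ 2 * gaussianSqVariance) := by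
    rw [hq, variance_fun_sum fun i => (hzsq i).const_mul _]
    have h1 : ∀ i, ∑ j, cov[fun ω => v i * z i ω ^ 2, fun ω => v j * z j ω ^ 2; P] =
        v i ^ 2 * gaussianSqVariance := by
      intro i
      rw [Finset.sum_eq_single i]
      · rw [covariance_self ((hzsq i).const_mul _).aemeasurable, variance_const_mul, hvar]
      · intro j _ hij
        rw [covariance_const_mul_left, covariance_const_mul_right]
        have : IndepFun (fun ω => z i ω ^ 2) (fun ω => z j ω ^ 2) P :=
          (hindep.indepFun hij.symm).comp (φ := fun x => x ^ 2) (ψ := fun x => x ^ 2)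
            (by fun_prop) (by fun_prop)
        rw [this.covariance_eq_zero (hzsq i) (hzsq j)]
        simp
      · simp
    simp only [h1]
    calc _ ≤ ∑ _i : Fin n, (u * ‖B‖) ^ 2 * gaussianSqVariance := by
          refine Finset.sum_le_sum fun i _ => ?_
          refine mul_le_mul_of_nonneg_right ?_ (variance_nonneg _ _)
          rw [← sq_abs]
          exact pow_le_pow_left₀ (abs_nonneg _) (hv i) 2
      _ = _ := by simp
  simp only [hqy, htr]
  refine (meas_ge_le_variance_div_sq hqL ht).trans (ENNReal.ofReal_le_ofReal ?_)
  gcongr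

end GaussianConcentration

/-! ### Combinatorics of the grid -/

section Grid

variable {d : ℕ} {v : ℕ → Fin d → ℕ}

theorem IsGridEnumeration.image_range (hv : IsGridEnumeration v) {N : ℕ} (hN : 1 ≤ N) :
    (Finset.range (N ^ d)).image v = Fintype.piFinset fun _ => Finset.Icc 1 N := by
  ext u
  have h := Set.ext_iff.1 (hv N hN) u
  simpa using h

theorem IsGridEnumeration.injective (hv : IsGridEnumeration v) (hd : 1 ≤ d) :
    Function.Injective v := by
  intro i j hij
  set N := max i j + 1 with hN
  have hNd : N ≤ N ^ d := Nat.le_self_pow (by omega) N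
  have hinj : Set.InjOn v (Finset.range (N ^ d)) := by
    refine Finset.injOn_of_card_image_eq ?_
    rw [hv.image_range (by omega), Fintype.card_piFinset]
    simp
  exact hinj (by simp; omega) (by simp; omega) hij

theorem IsGridEnumeration.isSeparatedFamily (hv : IsGridEnumeration v) (hd : 1 ≤ d) {ε : ℝ}
    (hε : 0 ≤ ε) {x : ℕ → EuclideanSpace ℝ (Fin d)}
    (hx : ∀ i k, x i k ∈ Set.Icc (-1 : ℝ) 1) (n : ℕ) :
    IsSeparatedFamily (1 - 2 * ε) fun i : Fin n => obsPoint v ε x i := by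
  intro i j hij
  have hvij : v i ≠ v j := fun h => hij (Fin.ext (hv.injective hd h))
  obtain ⟨k, hk⟩ := Function.ne_iff.1 hvij
  refine le_trans ?_ (PiLp.norm_apply_le _ k)
  have h1 : (1 : ℝ) ≤ |(v i k : ℝ) - v j k| := by
    have : (1 : ℤ) ≤ |(v i k : ℤ) - v j k| := Int.one_le_abs (by omega)
    exact_mod_cast this
  have h2 : |ε * (x i k - x j k)| ≤ 2 * ε := by
    rw [abs_mul, abs_of_nonneg hε, mul_comm]
    refine mul_le_mul_of_nonneg_right (abs_le.2 ?_) hε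
    constructor <;> linarith [(hx i k).1, (hx i k).2, (hx j k).1, (hx j k).2]
  have h3 : (obsPoint v ε x i - obsPoint v ε x j) k =
      ((v i k : ℝ) - v j k) - -(ε * (x i k - x j k)) := by
    simp [obsPoint]; ring
  rw [h3, Real.norm_eq_abs]
  have := abs_sub_abs_le_abs_sub ((v i k : ℝ) - v j k) (-(ε * (x i k - x j k)))
  rw [abs_neg] at this
  linarith

/-- A positive proportion of the first `n` grid points have their translate by `w` among the first
`n` grid points. -/
theorem IsGridEnumeration.exists_translates (hv : IsGridEnumeration v) (hd : 1 ≤ d)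
    (w : Fin d → ℤ) :
    ∃ σ : ℕ → ℕ, ∀ᶠ n : ℕ in atTop, ∃ G : Finset ℕ,
      (∀ i ∈ G, i < n ∧ σ i < n ∧ ∀ k, (v (σ i) k : ℤ) = v i k + w k) ∧
      (n : ℝ) / 4 ^ d ≤ G.card := by
  classical
  set H : ℕ := ∑ k, (w k).natAbs with hH
  have hwH : ∀ k, (w k).natAbs ≤ H := fun k =>
    Finset.single_le_sum (f := fun k => (w k).natAbs) (fun _ _ => Nat.zero_le _)
      (Finset.mem_univ k)
  set σ : ℕ → ℕ := fun i => if h : ∃ j, ∀ k, (v j k : ℤ) = v i k + w k then h.choose else 0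
    with hσ
  refine ⟨σ, eventually_atTop.2 ⟨(4 * H + 1) ^ d, fun n hn => ?_⟩⟩
  set N := Nat.findGreatest (fun N => N ^ d ≤ n) n with hN
  have hle : 4 * H + 1 ≤ (4 * H + 1) ^ d := Nat.le_self_pow (by omega) _
  have hNH : 4 * H + 1 ≤ N := Nat.le_findGreatest (hle.trans hn) hn
  have hNn : N ^ d ≤ n :=
    Nat.findGreatest_spec (P := fun N => N ^ d ≤ n) (hle.trans hn) hn
  have hnN : n < (N + 1) ^ d := by
    by_contra! hcon
    have : N + 1 ≤ n := (Nat.le_self_pow (by omega) _).trans hcon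
    have := Nat.le_findGreatest (P := fun N => N ^ d ≤ n) this hcon
    omega
  set G := (Finset.range n).filter fun i => σ i < n ∧ ∀ k, (v (σ i) k : ℤ) = v i k + w k with hG
  refine ⟨G, fun i hi => ?_, ?_⟩
  · simpa [hG] using hi
  have hsub : (Fintype.piFinset fun _ : Fin d => Finset.Icc (1 + H) (N - H)) ⊆ G.image v := by
    intro u hu
    rw [Fintype.mem_piFinset] at hu
    simp only [Finset.mem_Icc] at hu
    have hmem : ∀ u' : Fin d → ℕ, (∀ k, 1 ≤ u' k ∧ u' k ≤ N) → ∃ i < N ^ d, v i = u' := by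
      intro u' hu'
      have : u' ∈ (Finset.range (N ^ d)).image v := by
        rw [hv.image_range (by omega), Fintype.mem_piFinset]
        simpa using hu'
      simpa using this
    obtain ⟨i, hi, hiu⟩ := hmem u fun k => by have := hu k; omega
    obtain ⟨j, hj, hju⟩ := hmem (fun k => ((u k : ℤ) + w k).toNat) fun k => by
      have := hu k; have := hwH k; omega
    have hjw : ∀ k, (v j k : ℤ) = v i k + w k := fun k => by
      have h1 := hu k; have h2 := hwH k
      rw [hju, hiu]
      simp only
      omega
    have hex : ∃ j, ∀ k, (v j k : ℤ) = v i k + w k := ⟨j, hjw⟩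
    have hσi : σ i = hex.choose := by simp only [hσ]; rw [dif_pos hex]
    have hspec : ∀ k, (v (σ i) k : ℤ) = v i k + w k := by rw [hσi]; exact hex.choose_spec
    have hσj : σ i = j := hv.injective hd <| funext fun k => by
      have h1 := hspec k; have h2 := hjw k; omega
    refine Finset.mem_image.2 ⟨i, ?_, hiu⟩
    simp only [hG, Finset.mem_filter, Finset.mem_range]
    exact ⟨by omega, by omega, hspec⟩
  have hcard : (N - 2 * H) ^ d ≤ G.card := by
    have h1 := (Finset.card_le_card hsub).trans Finset.card_image_le
    rw [Fintype.card_piFinset] at h1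
    simp only [Nat.card_Icc, Finset.prod_const, Finset.card_univ, Fintype.card_fin] at h1
    rwa [show N - H + 1 - (1 + H) = N - 2 * H by omega] at h1
  rw [div_le_iff₀ (by positivity)]
  have h4 : n ≤ G.card * 4 ^ d :=
    calc n ≤ (N + 1) ^ d := hnN.le
      _ ≤ ((N - 2 * H) * 4) ^ d := Nat.pow_le_pow_left (by omega) d
      _ = (N - 2 * H) ^ d * 4 ^ d := mul_pow _ _ _
      _ ≤ G.card * 4 ^ d := Nat.mul_le_mul_right _ hcard
  exact_mod_cast h4

end Grid

/-! ### A law of large numbers for pairs of independent variables -/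

section PairCounts

variable {Ω E : Type*} [MeasurableSpace Ω] [MeasurableSpace E] {P : Measure Ω}
  [IsProbabilityMeasure P] {X : ℕ → Ω → E} {L : Measure E}

/-- Indicator of the product set `U × V`. -/
noncomputable def pairIndicator (U V : Set E) (x y : E) : ℝ :=
  U.indicator (fun _ => 1) x * V.indicator (fun _ => 1) y

omit [MeasurableSpace E] in
theorem pairIndicator_mem_Icc (U V : Set E) (x y : E) :
    pairIndicator U V x y ∈ Set.Icc (0 : ℝ) 1 := by
  unfold pairIndicator
  by_cases hx : x ∈ U <;> by_cases hy : y ∈ V <;> simp [hx, hy]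

theorem measurable_pairIndicator {U V : Set E} (hU : MeasurableSet U) (hV : MeasurableSet V) :
    Measurable fun z : E × E => pairIndicator U V z.1 z.2 :=
  ((measurable_const.indicator hU).comp measurable_fst).mul
    ((measurable_const.indicator hV).comp measurable_snd)

theorem measure_sum_pairIndicator_lt_le (hXm : ∀ i, Measurable (X i))
    (hXlaw : ∀ i, P.map (X i) = L) (hX : iIndepFun X P) {U V : Set E} (hU : MeasurableSet U)
    (hV : MeasurableSet V) {q : ℝ} (hq : 0 < q) (hqUV : q = L.real U * L.real V) (σ : ℕ → ℕ)
    (G : Finset ℕ) (hσ : ∀ i ∈ G, σ i ≠ i) (hinj : Set.InjOn σ G) (hG : 0 < G.card) :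
    P {ω | ∑ i ∈ G, pairIndicator U V (X (σ i) ω) (X i ω) < G.card * q / 2} ≤
      ENNReal.ofReal (12 / (G.card * q ^ 2)) := by
  classical
  set e : ℕ → Ω → ℝ := fun i ω => pairIndicator U V (X (σ i) ω) (X i ω) with he
  have hem : ∀ i, Measurable (e i) := fun i =>
    (measurable_pairIndicator hU hV).comp ((hXm (σ i)).prodMk (hXm i))
  have he01 : ∀ i ω, e i ω ∈ Set.Icc (0 : ℝ) 1 := fun i ω => pairIndicator_mem_Icc _ _ _ _
  have heL : ∀ i, MemLp (e i) 2 P := fun i =>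
    MemLp.of_bound (hem i).aestronglyMeasurable 1 (ae_of_all _ fun ω => by
      rw [Real.norm_eq_abs, abs_of_nonneg (he01 i ω).1]; exact (he01 i ω).2)
  have hint : ∀ (W : Set E), MeasurableSet W → ∀ i,
      ∫ ω, W.indicator (fun _ => (1 : ℝ)) (X i ω) ∂P = L.real W := by
    intro W hW i
    rw [← hXlaw i, ← integral_indicator_one hW]
    exact (integral_map (hXm i).aemeasurable
      (measurable_const.indicator hW).aestronglyMeasurable).symm
  have hmean : ∀ i ∈ G, ∫ ω, e i ω ∂P = q := by
    intro i hi
    have hind : IndepFun (fun ω => U.indicator (fun _ => (1 : ℝ)) (X (σ i) ω))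
        (fun ω => V.indicator (fun _ => (1 : ℝ)) (X i ω)) P :=
      (hX.indepFun (hσ i hi)).comp (measurable_const.indicator hU)
        (measurable_const.indicator hV)
    rw [hqUV, ← hint U hU (σ i), ← hint V hV i]
    exact hind.integral_fun_mul_eq_mul_integral
      ((measurable_const.indicator hU).comp (hXm _)).aestronglyMeasurable
      ((measurable_const.indicator hV).comp (hXm _)).aestronglyMeasurable
  have hcov1 : ∀ i ∈ G, ∀ j ∈ G, cov[e i, e j; P] ≤ 1 := by
    intro i hi j hj
    rw [covariance_eq_sub (heL i) (heL j), hmean i hi, hmean j hj]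
    have h1 : ∫ ω, (e i * e j) ω ∂P ≤ ∫ _ω, (1 : ℝ) ∂P := by
      refine integral_mono ((heL i).integrable_mul (heL j)) (integrable_const _) fun ω => ?_
      exact mul_le_one₀ (he01 i ω).2 (he01 j ω).1 (he01 j ω).2
    simp only [integral_const, probReal_univ, smul_eq_mul, mul_one] at h1
    nlinarith
  have hcov0 : ∀ i ∈ G, ∀ j ∈ G, j ≠ i → j ≠ σ i → σ j ≠ i → cov[e i, e j; P] = 0 := by
    intro i hi j hj h1 h2 h3
    have hind : IndepFun (fun ω => (X (σ i) ω, X i ω)) (fun ω => (X (σ j) ω, X j ω)) P :=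
      hX.indepFun_prodMk_prodMk hXm _ _ _ _ (fun h => h1 (hinj hi hj h).symm) h2.symm h3.symm
        h1.symm
    exact (hind.comp (measurable_pairIndicator hU hV)
      (measurable_pairIndicator hU hV)).covariance_eq_zero (heL i) (heL j)
  have hrow : ∀ i ∈ G, ∑ j ∈ G, cov[e i, e j; P] ≤ 3 := by
    intro i hi
    have h1 : ∀ j ∈ G, cov[e i, e j; P] ≤ (if j = i then (1 : ℝ) else 0) +
        (if j = σ i then 1 else 0) + (if σ j = i then 1 else 0) := by
      intro j hj
      by_cases c1 : j = i
      · rw [if_pos c1]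
        have := hcov1 i hi j hj
        split_ifs <;> linarith
      by_cases c2 : j = σ i
      · rw [if_pos c2]
        have := hcov1 i hi j hj
        split_ifs <;> linarith
      by_cases c3 : σ j = i
      · rw [if_pos c3]
        have := hcov1 i hi j hj
        split_ifs
        linarith
      · rw [hcov0 i hi j hj c1 c2 c3, if_neg c1, if_neg c2, if_neg c3]; norm_num
    have h2 : ∀ (r : ℕ → Prop) [DecidablePred r],
        (∀ j ∈ G, ∀ k ∈ G, r j → r k → j = k) → ∑ j ∈ G, (if r j then (1 : ℝ) else 0) ≤ 1 := by
      intro r _ hr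
      rw [Finset.sum_boole]
      have : (G.filter r).card ≤ 1 := Finset.card_le_one.2 fun a ha b hb =>
        hr a (Finset.mem_filter.1 ha).1 b (Finset.mem_filter.1 hb).1 (Finset.mem_filter.1 ha).2
          (Finset.mem_filter.1 hb).2
      exact_mod_cast this
    refine (Finset.sum_le_sum h1).trans ?_
    rw [Finset.sum_add_distrib, Finset.sum_add_distrib]
    have b1 := h2 (fun j => j = i) fun j _ k _ a b => a.trans b.symm
    have b2 := h2 (fun j => j = σ i) fun j _ k _ a b => a.trans b.symm
    have b3 := h2 (fun j => σ j = i) fun j hj k hk a b => hinj hj hk (a.trans b.symm)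
    linarith
  set T : Ω → ℝ := fun ω => ∑ i ∈ G, e i ω with hT
  have hTL : MemLp T 2 P := memLp_finsetSum _ fun i _ => heL i
  have hTm : ∫ ω, T ω ∂P = G.card * q := by
    rw [hT, integral_finsetSum _ fun i _ => (heL i).integrable one_le_two,
      Finset.sum_congr rfl hmean]
    simp
  have hTv : Var[T; P] ≤ 3 * G.card := by
    rw [hT, variance_fun_sum' fun i _ => heL i]
    refine (Finset.sum_le_sum hrow).trans (le_of_eq ?_)
    simp [mul_comm]
  have hGq : 0 < (G.card : ℝ) * q / 2 := by positivity
  calc P {ω | T ω < G.card * q / 2} ≤ P {ω | G.card * q / 2 ≤ |T ω - ∫ ω, T ω ∂P|} := by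
        refine measure_mono fun ω hω => ?_
        simp only [Set.mem_ofPred_eq] at hω ⊢
        rw [hTm, abs_sub_comm]
        exact le_trans (by linarith) (le_abs_self _)
    _ ≤ ENNReal.ofReal (Var[T; P] / (G.card * q / 2) ^ 2) := meas_ge_le_variance_div_sq hTL hGq
    _ ≤ ENNReal.ofReal (12 / (G.card * q ^ 2)) := by
        refine ENNReal.ofReal_le_ofReal ?_
        rw [div_le_div_iff₀ (by positivity) (by positivity)]
        have : 0 ≤ (G.card : ℝ) * q ^ 2 := by positivity
        nlinarith [mul_le_mul_of_nonneg_right hTv this]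

end PairCounts

/-! ### Measurability of the criterion -/

section Measurability

variable {Ω : Type*} [MeasurableSpace Ω] {m : Type*} [Fintype m] [DecidableEq m]

theorem Matrix.measurable_det_of_apply {M : Ω → Matrix m m ℝ}
    (hM : ∀ i j, Measurable fun ω => M ω i j) : Measurable fun ω => (M ω).det := by
  simp only [Matrix.det_apply]
  exact Finset.measurable_sum _ fun σ _ =>
    (Finset.measurable_prod _ fun i _ => hM (σ i) i).const_smul _

theorem Matrix.measurable_inv_apply {M : Ω → Matrix m m ℝ}
    (hM : ∀ i j, Measurable fun ω => M ω i j) (i j : m) :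
    Measurable fun ω => (M ω)⁻¹ i j := by
  simp only [Matrix.inv_def, Ring.inverse_eq_inv', Matrix.smul_apply, smul_eq_mul,
    Matrix.adjugate_apply]
  refine (Matrix.measurable_det_of_apply hM).inv.mul (Matrix.measurable_det_of_apply fun k l => ?_)
  simp only [Matrix.updateRow_apply]
  split_ifs
  exacts [measurable_const, hM k l]

theorem measurable_cvCriterion {d n : ℕ} {k : EuclideanSpace ℝ (Fin d) → ℝ} (hk : Measurable k)
    {s : Ω → Fin n → EuclideanSpace ℝ (Fin d)} (hs : ∀ i, Measurable fun ω => s ω i)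
    {y : Ω → Fin n → ℝ} (hy : ∀ i, Measurable fun ω => y ω i) :
    Measurable fun ω => cvCriterion k (s ω) (y ω) := by
  have hR : ∀ i j, Measurable fun ω => covMatrix k (s ω) i j := fun i j =>
    hk.comp ((hs i).sub (hs j))
  refine Finset.measurable_sum _ fun i _ => ((hy i).sub ?_).pow_const 2
  simp only [krigingLOO, dotProduct, Matrix.mulVec]
  refine Finset.measurable_sum _ fun j _ => (hR _ _).mul
    (Finset.measurable_sum _ fun l _ => Measurable.mul ?_ (hy l))
  exact Matrix.measurable_inv_apply (fun _ _ => hR _ _) j l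

/-- A bound on the measure of a set in a product space from bounds on its sections outside an
exceptional set. -/
theorem measure_prod_le_of_section {α β : Type*} [MeasurableSpace α] [MeasurableSpace β]
    {μ : Measure α} {ν : Measure β} [IsProbabilityMeasure μ] [SFinite ν] {E : Set (α × β)}
    (hE : MeasurableSet E) {S : Set α} {r : ℝ≥0∞} (hν : ∀ x, ν (Prod.mk x ⁻¹' E) ≤ 1)
    (h : ∀ᵐ x ∂μ, x ∉ S → ν (Prod.mk x ⁻¹' E) ≤ r) :
    μ.prod ν E ≤ μ S + r := by
  rw [Measure.prod_apply hE]
  calc ∫⁻ x, ν (Prod.mk x ⁻¹' E) ∂μ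
      ≤ ∫⁻ x, ((toMeasurable μ S).indicator 1 x + r) ∂μ := by
        refine lintegral_mono_ae (h.mono fun x hx => ?_)
        by_cases hxS : x ∈ toMeasurable μ S
        · rw [Set.indicator_of_mem hxS]
          exact (hν x).trans le_self_add
        · rw [Set.indicator_of_notMem hxS, zero_add]
          exact hx fun hS => hxS (subset_toMeasurable μ S hS)
    _ = μ S + r := by
        rw [lintegral_add_right _ measurable_const,
          lintegral_indicator_one (measurableSet_toMeasurable μ S), measure_toMeasurable]
        simp

end Measurability

/-! ### The cross validation criterion as a quadratic form -/

section QuadraticForm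

open scoped Matrix.Norms.L2Operator

variable {m : Type*} [Fintype m] [DecidableEq m]

theorem Matrix.abs_dotProduct_mulVec_le (M : Matrix m m ℝ) (x : m → ℝ) :
    |x ⬝ᵥ M *ᵥ x| ≤ ‖M‖ * (x ⬝ᵥ x) := by
  have h1 : (x ⬝ᵥ M *ᵥ x) ^ 2 ≤ (x ⬝ᵥ x) * ((M *ᵥ x) ⬝ᵥ (M *ᵥ x)) := by
    have := Finset.sum_mul_sq_le_sq_mul_sq Finset.univ x (M *ᵥ x)
    simpa only [dotProduct, sq] using this
  have hx : 0 ≤ x ⬝ᵥ x := Finset.sum_nonneg fun i _ => mul_self_nonneg _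
  refine abs_le_of_sq_le_sq ?_ (by positivity)
  calc _ ≤ (x ⬝ᵥ x) * ((M *ᵥ x) ⬝ᵥ (M *ᵥ x)) := h1
    _ ≤ (x ⬝ᵥ x) * (‖M‖ ^ 2 * (x ⬝ᵥ x)) := by gcongr; exact M.mulVec_dotProduct_mulVec_le x
    _ = _ := by ring

theorem Matrix.norm_transpose_mul_self_sub_le {A A' : Matrix m m ℝ} {α : ℝ} (hA : ‖A‖ ≤ α)
    (hA' : ‖A'‖ ≤ α) : ‖Aᵀ * A - A'ᵀ * A'‖ ≤ 2 * α * ‖A - A'‖ := by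
  have e : Aᵀ * A - A'ᵀ * A' = Aᵀ * (A - A') + (A - A')ᵀ * A' := by
    rw [Matrix.transpose_sub]; noncomm_ring
  rw [e]
  calc _ ≤ ‖Aᵀ‖ * ‖A - A'‖ + ‖(A - A')ᵀ‖ * ‖A'‖ :=
        (norm_add_le _ _).trans (add_le_add (norm_mul_le _ _) (norm_mul_le _ _))
    _ ≤ α * ‖A - A'‖ + ‖A - A'‖ * α := by
        rw [Matrix.l2_opNorm_transpose, Matrix.l2_opNorm_transpose]; gcongr
    _ = _ := by ring

theorem Matrix.SpectrumIn.cvCriterion_eq {d n : ℕ} {k : EuclideanSpace ℝ (Fin d) → ℝ}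
    {s : Fin n → EuclideanSpace ℝ (Fin d)} {l u : ℝ} (h : (covMatrix k s).SpectrumIn l u)
    (hl : 0 < l) (hu : 0 < u) (y : Fin n → ℝ) :
    cvCriterion k s y =
      y ⬝ᵥ ((covMatrix k s).looMatrixᵀ * (covMatrix k s).looMatrix) *ᵥ y := by
  rw [← Matrix.mulVec_mulVec, Matrix.dotProduct_mulVec, Matrix.vecMul_transpose]
  simp only [cvCriterion, h.sub_krigingLOO hl hu, dotProduct, sq]

theorem Matrix.SpectrumIn.cvCriterion_sub_eq {d n : ℕ} {k k' : EuclideanSpace ℝ (Fin d) → ℝ}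
    {s : Fin n → EuclideanSpace ℝ (Fin d)} {l u : ℝ} (h : (covMatrix k s).SpectrumIn l u)
    (h' : (covMatrix k' s).SpectrumIn l u) (hl : 0 < l) (hu : 0 < u) (y : Fin n → ℝ) :
    cvCriterion k s y - cvCriterion k' s y =
      y ⬝ᵥ ((covMatrix k s).looMatrixᵀ * (covMatrix k s).looMatrix -
        (covMatrix k' s).looMatrixᵀ * (covMatrix k' s).looMatrix) *ᵥ y := by
  rw [h.cvCriterion_eq hl hu, h'.cvCriterion_eq hl hu, Matrix.sub_mulVec, dotProduct_sub]

theorem Matrix.SpectrumIn.abs_cvCriterion_sub_le {d n : ℕ} {k k' : EuclideanSpace ℝ (Fin d) → ℝ}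
    {s : Fin n → EuclideanSpace ℝ (Fin d)} {l u : ℝ} (h : (covMatrix k s).SpectrumIn l u)
    (h' : (covMatrix k' s).SpectrumIn l u) (hl : 0 < l) (hu : 0 < u) (y : Fin n → ℝ) :
    |cvCriterion k s y - cvCriterion k' s y| ≤
      2 * (u ^ 2 / l ^ 2) * (u ^ 2 / l ^ 3 + u ^ 4 / l ^ 5) *
        ‖covMatrix k s - covMatrix k' s‖ * (y ⬝ᵥ y) := by
  rw [h.cvCriterion_sub_eq h' hl hu]
  refine (Matrix.abs_dotProduct_mulVec_le _ _).trans ?_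
  have hy : 0 ≤ y ⬝ᵥ y := Finset.sum_nonneg fun i _ => mul_self_nonneg _
  refine mul_le_mul_of_nonneg_right ?_ hy
  refine (Matrix.norm_transpose_mul_self_sub_le (h.norm_looMatrix_le hl hu)
    (h'.norm_looMatrix_le hl hu)).trans ?_
  rw [mul_assoc (2 * (u ^ 2 / l ^ 2))]
  gcongr
  exact h.norm_looMatrix_sub_le h' hl hu

end QuadraticForm

section GaussianObservations

open scoped Matrix.Norms.L2Operator

variable {d n : ℕ} {Ω : Type*} [MeasurableSpace Ω] {P : Measure Ω}
  {Y : EuclideanSpace ℝ (Fin d) → Ω → ℝ} {k₀ k : EuclideanSpace ℝ (Fin d) → ℝ}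
  {s : Fin n → EuclideanSpace ℝ (Fin d)} {l u : ℝ}

theorem ProbabilityTheory.IsGaussianProcess.hasGaussianLaw_pi {T : Type*} {Z : T → Ω → ℝ}
    (hZ : IsGaussianProcess Z P) {ι : Type*} [Fintype ι] (s : ι → T) :
    HasGaussianLaw (fun ω i => Z (s i) ω) P := by
  have h := (hZ.comp_right s).hasGaussianLaw Finset.univ
  let T' : (↥(Finset.univ : Finset ι) → ℝ) →ₗ[ℝ] (ι → ℝ) :=
    LinearMap.funLeft ℝ ℝ fun i => ⟨i, Finset.mem_univ i⟩
  exact h.map_fun T'.toContinuousLinearMap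

theorem IsCenteredGaussianProcess.measure_quadratic_form_le [IsProbabilityMeasure P]
    (hY : IsCenteredGaussianProcess Y P k₀) (hR : (covMatrix k₀ s).SpectrumIn l u) (hl : 0 < l)
    (hu : 0 < u) {B : Matrix (Fin n) (Fin n) ℝ} (hB : Bᵀ = B) {β t : ℝ} (hβ : ‖B‖ ≤ β)
    (ht : 0 < t) :
    P {ω | t ≤ |(fun i => Y (s i) ω) ⬝ᵥ B *ᵥ (fun i => Y (s i) ω) -
      (B * covMatrix k₀ s).trace|} ≤
      ENNReal.ofReal (n * ((u * β) ^ 2 * gaussianSqVariance) / t ^ 2) := by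
  refine (measure_gaussian_quadratic_form_le (hY.gaussian.hasGaussianLaw_pi s)
    (fun i => hY.centered _) hR hl (fun i j => hY.covariance _ _) hB ht).trans
    (ENNReal.ofReal_le_ofReal ?_)
  have : 0 ≤ gaussianSqVariance := variance_nonneg _ _
  gcongr

/-- The sum of squares of the observations exceeds twice its mean with small probability. -/
theorem IsCenteredGaussianProcess.measure_sum_sq_gt_le [IsProbabilityMeasure P]
    (hY : IsCenteredGaussianProcess Y P k₀) (hR : (covMatrix k₀ s).SpectrumIn l u) (hl : 0 < l)
    (hu : 0 < u) (h1 : k₀ 0 = 1) (hn : 0 < n) :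
    P {ω | 2 * (n : ℝ) < (fun i => Y (s i) ω) ⬝ᵥ (fun i => Y (s i) ω)} ≤
      ENNReal.ofReal (u ^ 2 * gaussianSqVariance / n) := by
  have hone : ‖(1 : Matrix (Fin n) (Fin n) ℝ)‖ ≤ 1 := by
    rw [← Matrix.diagonal_one]
    exact Matrix.l2_opNorm_diagonal_le zero_le_one fun i => by simp
  have hn' : (0 : ℝ) < n := by exact_mod_cast hn
  have h := hY.measure_quadratic_form_le hR hl hu (Matrix.transpose_one) hone hn'
  have htr : ((1 : Matrix (Fin n) (Fin n) ℝ) * covMatrix k₀ s).trace = n := by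
    simp [Matrix.trace, covMatrix, h1]
  rw [htr] at h
  simp only [Matrix.one_mulVec] at h
  refine le_trans (measure_mono fun ω hω => ?_) (h.trans (le_of_eq ?_))
  · simp only [Set.mem_ofPred_eq] at hω ⊢
    exact le_trans (by linarith) (le_abs_self _)
  · congr 1; field_simp

/-- When the covariance matrices of the true and of a candidate model differ markedly, the cross
validation criterion separates them with large probability. -/
theorem IsCenteredGaussianProcess.measure_cvCriterion_sub_lt_le [IsProbabilityMeasure P]
    (hY : IsCenteredGaussianProcess Y P k₀) (hR₀ : (covMatrix k₀ s).SpectrumIn l u)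
    (hR : (covMatrix k s).SpectrumIn l u) (hl : 0 < l) (hu : 0 < u) (h1 : k₀ 0 = 1)
    (hk1 : k 0 = 1) (hn : 0 < n) {γ : ℝ} (hγ : 0 < γ)
    (hfrob : 4 * (1 + u ^ 2) * (u ^ 2 / l) ^ 2 / l * γ * n ≤
      (covMatrix k s - covMatrix k₀ s).frobSq) :
    P {ω | cvCriterion k s (fun i => Y (s i) ω) - cvCriterion k₀ s (fun i => Y (s i) ω) < γ * n} ≤
      ENNReal.ofReal ((u * (2 * (u ^ 2 / l ^ 2) * (2 * (u ^ 2 / l ^ 2)))) ^ 2 *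
        gaussianSqVariance / γ ^ 2 / n) := by
  set A := (covMatrix k s).looMatrix with hA
  set A₀ := (covMatrix k₀ s).looMatrix with hA₀
  have hn' : (0 : ℝ) < n := by exact_mod_cast hn
  have hB : (Aᵀ * A - A₀ᵀ * A₀)ᵀ = Aᵀ * A - A₀ᵀ * A₀ := by
    simp [Matrix.transpose_sub, Matrix.transpose_mul]
  have hnA := hR.norm_looMatrix_le hl hu
  have hnA₀ := hR₀.norm_looMatrix_le hl hu
  have hBn : ‖Aᵀ * A - A₀ᵀ * A₀‖ ≤ 2 * (u ^ 2 / l ^ 2) * (2 * (u ^ 2 / l ^ 2)) := by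
    refine (Matrix.norm_transpose_mul_self_sub_le hnA hnA₀).trans ?_
    gcongr
    refine (norm_sub_le _ _).trans ?_
    rw [two_mul]
    exact add_le_add hnA hnA₀
  have htr : 2 * (γ * n) ≤ ((Aᵀ * A - A₀ᵀ * A₀) * covMatrix k₀ s).trace := by
    refine le_trans ?_ (hR.le_trace_looMatrix hR₀ hl hu)
    have h2 := hR.frobSq_sub_le hR₀ hl hu (fun i => by simp [covMatrix, hk1])
      (fun i => by simp [covMatrix, h1])
    have h3 := hfrob.trans h2
    set F := (A - A₀).frobSq
    have hc : 0 < 2 * (1 + u ^ 2) * (u ^ 2 / l) ^ 2 := by positivity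
    have h4 : 2 * (1 + u ^ 2) * (u ^ 2 / l) ^ 2 * (2 * (γ * n) / l) ≤
        2 * (1 + u ^ 2) * (u ^ 2 / l) ^ 2 * F := le_trans (le_of_eq (by ring)) h3
    have h5 := le_of_mul_le_mul_left h4 hc
    rw [div_le_iff₀ hl] at h5
    linarith
  refine le_trans (measure_mono fun ω hω => ?_) ((hY.measure_quadratic_form_le hR₀ hl hu hB hBn
    (mul_pos hγ hn')).trans (le_of_eq ?_))
  · simp only [Set.mem_ofPred_eq] at hω ⊢
    rw [hR.cvCriterion_sub_eq hR₀ hl hu] at hω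
    rw [abs_sub_comm]
    exact le_trans (by linarith) (le_abs_self _)
  · congr 1; field_simp

end GaussianObservations

/-! ### Consistency of cross validation -/

theorem tendsto_ofReal_const_div_nat (C : ℝ) :
    Tendsto (fun n : ℕ => ENNReal.ofReal (C / n)) atTop (𝓝 0) := by
  simpa using ENNReal.tendsto_ofReal (tendsto_const_div_atTop_nhds_zero_nat C)

/-- The function `g` is bounded away from zero, with positive probability, at the difference of
two perturbed grid points. -/
def IsSeenByPairs {d : ℕ} (L : Measure (EuclideanSpace ℝ (Fin d))) (ε : ℝ)
    (g : EuclideanSpace ℝ (Fin d) → ℝ) : Prop :=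
  ∃ w : Fin d → ℤ, w ≠ 0 ∧ ∃ U V : Set (EuclideanSpace ℝ (Fin d)), MeasurableSet U ∧
    MeasurableSet V ∧ 0 < L U ∧ 0 < L V ∧ ∃ c : ℝ, 0 < c ∧ ∀ x ∈ U, ∀ y ∈ V,
      c ≤ |g (WithLp.toLp 2 (fun k => (w k : ℝ)) + ε • (x - y))|

theorem isSeenByPairs_zero {d : ℕ} (L : Measure (EuclideanSpace ℝ (Fin d)))
    [IsProbabilityMeasure L] {g : EuclideanSpace ℝ (Fin d) → ℝ} (hg0 : g 0 = 0)
    (h : ∃ w : Fin d → ℤ, g (WithLp.toLp 2 (fun k => (w k : ℝ))) ≠ 0) :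
    IsSeenByPairs L 0 g := by
  obtain ⟨w, hw⟩ := h
  refine ⟨w, ?_, Set.univ, Set.univ, .univ, .univ, by simp, by simp, _, abs_pos.2 hw,
    fun x _ y _ => by simp⟩
  rintro rfl
  refine hw ?_
  have : (WithLp.toLp 2 fun k => (((0 : Fin d → ℤ) k : ℤ) : ℝ)) =
      (0 : EuclideanSpace ℝ (Fin d)) := by ext k; simp
  rw [this, hg0]

theorem isSeenByPairs_of_not_ae {d : ℕ} {L : Measure (EuclideanSpace ℝ (Fin d))} {ε : ℝ}
    {g : EuclideanSpace ℝ (Fin d) → ℝ} (hg : Continuous g)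
    (h : ¬ ∀ᵐ t ∂(volume.restrict (interpointSet ε L.support)), g t = 0) :
    IsSeenByPairs L ε g := by
  have hex : ∃ t ∈ interpointSet ε L.support, g t ≠ 0 := by
    by_contra! hcon
    refine h ?_
    have hm : MeasurableSet {t | g t = 0} := (isClosed_eq hg continuous_const).measurableSet
    rw [ae_restrict_iff hm]
    exact ae_of_all _ hcon
  obtain ⟨t, ⟨w, hw, t₁, ht₁, t₂, ht₂, rfl⟩, ht⟩ := hex
  set f : EuclideanSpace ℝ (Fin d) × EuclideanSpace ℝ (Fin d) → ℝ := fun z =>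
    |g (WithLp.toLp 2 (fun k => (w k : ℝ)) + ε • (z.1 - z.2))| with hf
  have hfc : Continuous f := by fun_prop
  have hpos : 0 < f (t₁, t₂) := abs_pos.2 ht
  have hnhds : {z | f (t₁, t₂) / 2 < f z} ∈ 𝓝 (t₁, t₂) :=
    (isOpen_lt continuous_const hfc).mem_nhds (half_lt_self hpos)
  obtain ⟨U, V, hUo, hU, hVo, hV, hUV⟩ := mem_nhds_prod_iff'.1 hnhds
  exact ⟨w, hw, U, V, hUo.measurableSet, hVo.measurableSet,
    (Measure.mem_support_iff_forall t₁).1 ht₁ U (hUo.mem_nhds hU),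
    (Measure.mem_support_iff_forall t₂).1 ht₂ V (hVo.mem_nhds hV), _, half_pos hpos,
    fun x hx y hy => le_of_lt (hUV (Set.mk_mem_prod hx hy))⟩

/-- The difference of two covariance matrices is bounded below by a count of pairs. -/
theorem le_frobSq_covMatrix_sub {d : ℕ} {v : ℕ → Fin d → ℕ} {ε : ℝ}
    {k k₀ : EuclideanSpace ℝ (Fin d) → ℝ} {w : Fin d → ℤ}
    {U V : Set (EuclideanSpace ℝ (Fin d))} {c : ℝ} (hc : 0 < c)
    (h : ∀ x ∈ U, ∀ y ∈ V, c ≤ |(k - k₀) (WithLp.toLp 2 (fun k => (w k : ℝ)) + ε • (x - y))|)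
    (x : ℕ → EuclideanSpace ℝ (Fin d)) {n : ℕ} {σ : ℕ → ℕ} {G : Finset ℕ}
    (hG : ∀ i ∈ G, i < n ∧ σ i < n ∧ ∀ k, (v (σ i) k : ℤ) = v i k + w k) :
    c ^ 2 * ∑ i ∈ G, pairIndicator U V (x (σ i)) (x i) ≤
      (covMatrix k (fun i : Fin n => obsPoint v ε x i) -
        covMatrix k₀ (fun i : Fin n => obsPoint v ε x i)).frobSq := by
  set F : ℕ → ℕ → ℝ := fun j i => (k - k₀) (obsPoint v ε x j - obsPoint v ε x i) ^ 2 with hF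
  have hF0 : ∀ j i, 0 ≤ F j i := fun j i => sq_nonneg _
  have e : (covMatrix k (fun i : Fin n => obsPoint v ε x i) -
      covMatrix k₀ (fun i : Fin n => obsPoint v ε x i)).frobSq =
      ∑ i ∈ Finset.range n, ∑ j ∈ Finset.range n, F j i := by
    simp only [Finset.sum_range]
    rw [Matrix.frobSq, Finset.sum_comm]
    rfl
  rw [e, Finset.mul_sum]
  have hGsub : G ⊆ Finset.range n := fun i hi => Finset.mem_range.2 (hG i hi).1
  refine le_trans (Finset.sum_le_sum fun i hi => ?_) (Finset.sum_le_sum_of_subset_of_nonneg hGsub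
    fun i _ _ => Finset.sum_nonneg fun j _ => hF0 j i)
  refine le_trans ?_ (Finset.single_le_sum (fun j _ => hF0 j i)
    (Finset.mem_range.2 (hG i hi).2.1))
  have hdiff : obsPoint v ε x (σ i) - obsPoint v ε x i =
      WithLp.toLp 2 (fun k => (w k : ℝ)) + ε • (x (σ i) - x i) := by
    ext j
    have h1 : (v (σ i) j : ℝ) = v i j + w j := by exact_mod_cast (hG i hi).2.2 j
    simp [obsPoint, h1]
    ring
  simp only [hF, hdiff]
  by_cases hx : x (σ i) ∈ U <;> by_cases hy : x i ∈ V
  · have := h _ hx _ hy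
    rw [pairIndicator, Set.indicator_of_mem hx, Set.indicator_of_mem hy, mul_one, mul_one,
      ← sq_abs ((k - k₀) _)]
    exact pow_le_pow_left₀ hc.le this 2
  all_goals simp only [pairIndicator, hx, hy, not_false_eq_true, Set.indicator_of_notMem,
    zero_mul, mul_zero]; exact sq_nonneg _

section Consistency

variable {d p : ℕ} {a b : ℝ} {θ₀ : Fin p → ℝ} {K : (Fin p → ℝ) → EuclideanSpace ℝ (Fin d) → ℝ}
  {v : ℕ → Fin d → ℕ} {ε : ℝ} {L : Measure (EuclideanSpace ℝ (Fin d))}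
  {ΩX ΩY : Type*} [MeasurableSpace ΩX] [MeasurableSpace ΩY]
  {PX : Measure ΩX} {PY : Measure ΩY}
  {X : ℕ → ΩX → EuclideanSpace ℝ (Fin d)} {Y : EuclideanSpace ℝ (Fin d) → ΩY → ℝ}

theorem measurable_obsPoint (hXm : ∀ i, Measurable (X i)) (i : ℕ) :
    Measurable fun ω : ΩX × ΩY => obsPoint v ε (fun j => X j ω.1) i :=
  (((hXm i).comp measurable_fst).const_smul ε).const_add _

/-- The cross validation criterion as a random variable. -/
noncomputable def cvRandom (K : (Fin p → ℝ) → EuclideanSpace ℝ (Fin d) → ℝ) (v : ℕ → Fin d → ℕ)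
    (ε : ℝ) (X : ℕ → ΩX → EuclideanSpace ℝ (Fin d)) (Y : EuclideanSpace ℝ (Fin d) → ΩY → ℝ)
    (n : ℕ) (θ : Fin p → ℝ) (ω : ΩX × ΩY) : ℝ :=
  cvCriterion (K θ) (fun i : Fin n => obsPoint v ε (fun j => X j ω.1) i)
    (fun i : Fin n => Y (obsPoint v ε (fun j => X j ω.1) i) ω.2)

/-- The sum of the squares of the observations. -/
noncomputable def sumSqRandom (v : ℕ → Fin d → ℕ)
    (ε : ℝ) (X : ℕ → ΩX → EuclideanSpace ℝ (Fin d)) (Y : EuclideanSpace ℝ (Fin d) → ΩY → ℝ)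
    (n : ℕ) (ω : ΩX × ΩY) : ℝ :=
  (fun i : Fin n => Y (obsPoint v ε (fun j => X j ω.1) i) ω.2) ⬝ᵥ
    (fun i : Fin n => Y (obsPoint v ε (fun j => X j ω.1) i) ω.2)

theorem measurable_cvRandom (hK : IsRegularCovarianceModel a b K) (hXm : ∀ i, Measurable (X i))
    (hYm : ∀ i, Measurable
      (fun ω : ΩX × ΩY => Y (obsPoint v ε (fun j => X j ω.1) i) ω.2))
    {θ : Fin p → ℝ} (hθ : θ ∈ paramCube p a b) (n : ℕ) :
    Measurable (cvRandom K v ε X Y n θ) :=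
  measurable_cvCriterion (hK.continuous hθ).measurable
    (fun i => measurable_obsPoint hXm i) fun i => hYm i

theorem measurable_sumSqRandom
    (hYm : ∀ i, Measurable
      (fun ω : ΩX × ΩY => Y (obsPoint v ε (fun j => X j ω.1) i) ω.2)) (n : ℕ) :
    Measurable (sumSqRandom v ε X Y n) := by
  unfold sumSqRandom
  simp only [dotProduct]
  exact Finset.measurable_sum _ fun i _ => (hYm i).mul (hYm i)

omit [MeasurableSpace ΩX] [MeasurableSpace ΩY] in
theorem sumSqRandom_nonneg (n : ℕ) (ω : ΩX × ΩY) : 0 ≤ sumSqRandom v ε X Y n ω := by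
  unfold sumSqRandom
  exact Finset.sum_nonneg fun _ _ => mul_self_nonneg _

theorem IsPerturbationLaw.ae_mem_Icc (hL : IsPerturbationLaw L) (hXm : ∀ i, Measurable (X i))
    (hXlaw : ∀ i, PX.map (X i) = L) :
    ∀ᵐ x ∂PX, ∀ i k, X i x k ∈ Set.Icc (-1 : ℝ) 1 := by
  rw [ae_all_iff]
  intro i
  have h : ∀ᵐ y ∂(PX.map (X i)), y ∈ L.support := by
    rw [hXlaw]; exact Measure.support_mem_ae
  exact (ae_of_ae_map (hXm i).aemeasurable h).mono fun x hx => hL.support_subset _ hx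

variable [IsProbabilityMeasure PX] [IsProbabilityMeasure PY]

theorem tendsto_measure_sumSqRandom (hd : 1 ≤ d) (hK : IsRegularCovarianceModel a b K)
    (hK1 : ∀ θ ∈ paramCube p a b, K θ 0 = 1) (hθ₀ : θ₀ ∈ paramCube p a b)
    (hv : IsGridEnumeration v) (hε0 : 0 ≤ ε) (hε : ε < 1 / 2)
    (hXbd : ∀ᵐ x ∂PX, ∀ i k, X i x k ∈ Set.Icc (-1 : ℝ) 1)
    (hY : IsCenteredGaussianProcess Y PY (K θ₀))
    (hYm : ∀ i, Measurable
      (fun ω : ΩX × ΩY => Y (obsPoint v ε (fun j => X j ω.1) i) ω.2)) :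
    Tendsto (fun n : ℕ => PX.prod PY {ω | 2 * (n : ℝ) < sumSqRandom v ε X Y n ω})
      atTop (𝓝 0) := by
  obtain ⟨l, u, hl, hu, hspec⟩ := hK.exists_spectrumIn (δ := 1 - 2 * ε) (by linarith)
  refine tendsto_of_tendsto_of_tendsto_of_le_of_le' tendsto_const_nhds
    (tendsto_ofReal_const_div_nat (u ^ 2 * gaussianSqVariance)) (Eventually.of_forall fun _ =>
      zero_le) (eventually_atTop.2 ⟨1, fun n hn => ?_⟩)
  have hE : MeasurableSet {ω | 2 * (n : ℝ) < sumSqRandom v ε X Y n ω} :=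
    measurableSet_lt measurable_const (measurable_sumSqRandom hYm n)
  have h := measure_prod_le_of_section (μ := PX) (ν := PY) hE (S := ∅)
    (r := ENNReal.ofReal (u ^ 2 * gaussianSqVariance / n)) (fun x => prob_le_one)
    (hXbd.mono fun x hx _ => hY.measure_sum_sq_gt_le (hspec θ₀ hθ₀ n _
      (hv.isSeparatedFamily hd hε0 hx n)) hl hu (hK1 θ₀ hθ₀) hn)
  rwa [measure_empty, zero_add] at h

theorem exists_tendsto_measure_cvRandom_sub_lt (hd : 1 ≤ d) (hK : IsRegularCovarianceModel a b K)
    (hK1 : ∀ θ ∈ paramCube p a b, K θ 0 = 1) (hθ₀ : θ₀ ∈ paramCube p a b)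
    (hv : IsGridEnumeration v) (hε0 : 0 ≤ ε) (hε : ε < 1 / 2)
    (hXm : ∀ i, Measurable (X i)) (hXlaw : ∀ i, PX.map (X i) = L) (hXindep : iIndepFun X PX)
    (hXbd : ∀ᵐ x ∂PX, ∀ i k, X i x k ∈ Set.Icc (-1 : ℝ) 1)
    (hY : IsCenteredGaussianProcess Y PY (K θ₀))
    (hYm : ∀ i, Measurable
      (fun ω : ΩX × ΩY => Y (obsPoint v ε (fun j => X j ω.1) i) ω.2))
    {θ : Fin p → ℝ} (hθ : θ ∈ paramCube p a b) (hsee : IsSeenByPairs L ε (K θ - K θ₀)) :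
    ∃ γ : ℝ, 0 < γ ∧ Tendsto (fun n : ℕ => PX.prod PY
      {ω | cvRandom K v ε X Y n θ ω - cvRandom K v ε X Y n θ₀ ω < γ * n}) atTop (𝓝 0) := by
  obtain ⟨l, u, hl, hu, hspec⟩ := hK.exists_spectrumIn (δ := 1 - 2 * ε) (by linarith)
  obtain ⟨w, hw, U, V, hUm, hVm, hU, hV, c, hc, hsep⟩ := hsee
  have hLp : IsProbabilityMeasure L := by
    rw [← hXlaw 0]; exact Measure.isProbabilityMeasure_map (hXm 0).aemeasurable
  set q := L.real U * L.real V with hq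
  have hq0 : 0 < q := mul_pos (ENNReal.toReal_pos hU.ne' (measure_ne_top _ _))
    (ENNReal.toReal_pos hV.ne' (measure_ne_top _ _))
  obtain ⟨σ, hσ⟩ := hv.exists_translates hd w
  set C₁ : ℝ := 4 * (1 + u ^ 2) * (u ^ 2 / l) ^ 2 / l with hC₁
  have hC₁pos : 0 < C₁ := by positivity
  set γ : ℝ := c ^ 2 * q / (2 * 4 ^ d) / C₁ with hγ
  have hγpos : 0 < γ := by positivity
  set C₂ : ℝ := (u * (2 * (u ^ 2 / l ^ 2) * (2 * (u ^ 2 / l ^ 2)))) ^ 2 *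
    gaussianSqVariance / γ ^ 2 with hC₂
  refine ⟨γ, hγpos, ?_⟩
  have hlim := (tendsto_ofReal_const_div_nat (12 * 4 ^ d / q ^ 2)).add
    (tendsto_ofReal_const_div_nat C₂)
  rw [add_zero] at hlim
  refine tendsto_of_tendsto_of_tendsto_of_le_of_le' tendsto_const_nhds hlim
    (Eventually.of_forall fun _ => zero_le) ?_
  filter_upwards [hσ, eventually_ge_atTop 1] with n hn hn1
  obtain ⟨G, hG, hGcard⟩ := hn
  have hn0 : (0 : ℝ) < n := by exact_mod_cast hn1
  have hGpos : (0 : ℝ) < G.card := lt_of_lt_of_le (by positivity) hGcard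
  have hE : MeasurableSet
      {ω | cvRandom K v ε X Y n θ ω - cvRandom K v ε X Y n θ₀ ω < γ * n} :=
    measurableSet_lt ((measurable_cvRandom hK hXm hYm hθ n).sub
      (measurable_cvRandom hK hXm hYm hθ₀ n)) measurable_const
  have hσne : ∀ i ∈ G, σ i ≠ i := by
    intro i hi h
    refine hw (funext fun k => ?_)
    have := (hG i hi).2.2 k
    rw [h] at this
    simp only [Pi.zero_apply]
    omega
  have hσinj : Set.InjOn σ G := by
    intro i hi j hj hij
    refine hv.injective hd (funext fun k => ?_)
    have h1 := (hG i hi).2.2 k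
    have h2 := (hG j hj).2.2 k
    rw [hij] at h1
    omega
  refine (measure_prod_le_of_section hE
    (S := {x | ∑ i ∈ G, pairIndicator U V (X (σ i) x) (X i x) < G.card * q / 2})
    (r := ENNReal.ofReal (C₂ / n)) (fun x => prob_le_one) (hXbd.mono fun x hx hxS => ?_)).trans
    (add_le_add ((measure_sum_pairIndicator_lt_le hXm hXlaw hXindep hUm hVm hq0 hq σ G hσne
      hσinj (by exact_mod_cast hGpos)).trans (ENNReal.ofReal_le_ofReal ?_)) le_rfl)
  · have hs := hv.isSeparatedFamily hd hε0 hx n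
    refine hY.measure_cvCriterion_sub_lt_le (hspec θ₀ hθ₀ n _ hs) (hspec θ hθ n _ hs) hl hu
      (hK1 θ₀ hθ₀) (hK1 θ hθ) hn1 hγpos ?_
    refine le_trans ?_ (le_frobSq_covMatrix_sub hc hsep (fun j => X j x) hG)
    simp only [Set.mem_ofPred_eq, not_lt] at hxS
    calc C₁ * γ * n = c ^ 2 * ((n : ℝ) / 4 ^ d * q / 2) := by rw [hγ]; field_simp
      _ ≤ c ^ 2 * (G.card * q / 2) := by gcongr
      _ ≤ _ := by gcongr
  · rw [div_le_div_iff₀ (by positivity) hn0]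
    rw [div_le_iff₀ (by positivity)] at hGcard
    calc 12 * (n : ℝ) ≤ 12 * (G.card * 4 ^ d) := by gcongr
      _ = 12 * 4 ^ d / q ^ 2 * (G.card * q ^ 2) := by field_simp

theorem tendstoInMeasure_of_isSeenByPairs (hd : 1 ≤ d) (hθ₀ : ∀ i, a < θ₀ i ∧ θ₀ i < b)
    (hK : IsRegularCovarianceModel a b K) (hK1 : ∀ θ ∈ paramCube p a b, K θ 0 = 1)
    (hv : IsGridEnumeration v) (hε0 : 0 ≤ ε) (hε : ε < 1 / 2) (hL : IsPerturbationLaw L)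
    (hXm : ∀ i, Measurable (X i)) (hXlaw : ∀ i, PX.map (X i) = L) (hXindep : iIndepFun X PX)
    (hY : IsCenteredGaussianProcess Y PY (K θ₀))
    (hYm : ∀ i, Measurable
      (fun ω : ΩX × ΩY => Y (obsPoint v ε (fun j => X j ω.1) i) ω.2))
    {θhat : ℕ → ΩX × ΩY → Fin p → ℝ} (hθhat : IsCVEstimator a b K v ε PX X PY Y θhat)
    (hsee : ∀ θ ∈ paramCube p a b, θ ≠ θ₀ → IsSeenByPairs L ε (K θ - K θ₀)) :
    TendstoInMeasure (PX.prod PY) θhat atTop (fun _ => θ₀) := by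
  have hθ₀' : θ₀ ∈ paramCube p a b := fun i => ⟨(hθ₀ i).1.le, (hθ₀ i).2.le⟩
  have hXbd := hL.ae_mem_Icc hXm hXlaw
  obtain ⟨l, u, hl, hu, hspec⟩ := hK.exists_spectrumIn (δ := 1 - 2 * ε) (by linarith)
  obtain ⟨C, hC, hlip⟩ := hK.exists_covMatrix_lipschitz (fun i => (hθ₀ i).1.trans (hθ₀ i).2)
    (δ := 1 - 2 * ε) (by linarith)
  set D : ℝ := 2 * (u ^ 2 / l ^ 2) * (u ^ 2 / l ^ 3 + u ^ 4 / l ^ 5) * C with hD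
  have hDpos : 0 < D := by positivity
  have hcvlip : ∀ᵐ ω ∂(PX.prod PY), ∀ n, ∀ θ ∈ paramCube p a b, ∀ θ' ∈ paramCube p a b,
      |cvRandom K v ε X Y n θ ω - cvRandom K v ε X Y n θ' ω| ≤
        D * ‖θ - θ'‖ * sumSqRandom v ε X Y n ω := by
    have h1 : ∀ᵐ ω ∂(PX.prod PY), ∀ i k, X i ω.1 k ∈ Set.Icc (-1 : ℝ) 1 :=
      Measure.quasiMeasurePreserving_fst.ae hXbd
    refine h1.mono fun ω hω n θ hθ θ' hθ' => ?_
    have hs := hv.isSeparatedFamily hd hε0 hω n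
    refine ((hspec θ hθ n _ hs).abs_cvCriterion_sub_le (hspec θ' hθ' n _ hs) hl hu _).trans ?_
    refine mul_le_mul_of_nonneg_right ?_ (sumSqRandom_nonneg n ω)
    rw [hD, mul_assoc _ C]
    gcongr
    exact hlip θ hθ θ' hθ' n _ hs
  have hcore : ∀ θ, ∃ γ : ℝ, 0 < γ ∧ (θ ∈ paramCube p a b → θ ≠ θ₀ →
      Tendsto (fun n : ℕ => PX.prod PY
        {ω | cvRandom K v ε X Y n θ ω - cvRandom K v ε X Y n θ₀ ω < γ * n}) atTop (𝓝 0)) := by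
    intro θ
    by_cases h : θ ∈ paramCube p a b ∧ θ ≠ θ₀
    · obtain ⟨γ, hγ, h'⟩ := exists_tendsto_measure_cvRandom_sub_lt hd hK hK1 hθ₀' hv hε0 hε hXm
        hXlaw hXindep hXbd hY hYm h.1 (hsee θ h.1 h.2)
      exact ⟨γ, hγ, fun _ _ => h'⟩
    · exact ⟨1, one_pos, fun h1 h2 => absurd ⟨h1, h2⟩ h⟩
  choose γ hγpos hγ using hcore
  rw [tendstoInMeasure_iff_dist]
  intro η hη
  set S : Set (Fin p → ℝ) := paramCube p a b ∩ {θ | η ≤ dist θ θ₀} with hS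
  have hScomp : IsCompact S := (isCompact_paramCube p a b).inter_right
    (isClosed_le continuous_const (by fun_prop))
  have hSne : ∀ θ ∈ S, θ ≠ θ₀ := by
    rintro θ hθ rfl
    have := hθ.2
    simp only [Set.mem_ofPred_eq, dist_self] at this
    linarith
  obtain ⟨T, hTS, hT⟩ := hScomp.elim_nhds_subcover
    (fun θ => Metric.ball θ (γ θ / (4 * D)))
    fun θ _ => Metric.ball_mem_nhds θ (div_pos (hγpos θ) (by positivity))
  have hlim : Tendsto (fun n : ℕ =>
      PX.prod PY {ω | 2 * (n : ℝ) < sumSqRandom v ε X Y n ω} + ∑ θ ∈ T, PX.prod PY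
        {ω | cvRandom K v ε X Y n θ ω - cvRandom K v ε X Y n θ₀ ω < γ θ * n}) atTop (𝓝 0) := by
    have h1 := tendsto_finsetSum T fun θ hθ => hγ θ (hTS θ hθ).1 (hSne θ (hTS θ hθ))
    have h2 := (tendsto_measure_sumSqRandom hd hK hK1 hθ₀' hv hε0 hε hXbd hY hYm).add h1
    simpa using h2
  refine tendsto_of_tendsto_of_tendsto_of_le_of_le' tendsto_const_nhds hlim
    (Eventually.of_forall fun _ => zero_le) (eventually_atTop.2 ⟨1, fun n hn => ?_⟩)
  have hn0 : (0 : ℝ) < n := by exact_mod_cast hn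
  refine le_trans (measure_mono_ae ?_) ((measure_union_le _ _).trans
    (add_le_add le_rfl (measure_biUnion_finset_le T _)))
  filter_upwards [hcvlip, hθhat n hn] with ω hω hmin hdist
  by_contra hcon
  have hcon' : ¬ (2 * (n : ℝ) < sumSqRandom v ε X Y n ω) ∧ ∀ θ ∈ T,
      ¬ (cvRandom K v ε X Y n θ ω - cvRandom K v ε X Y n θ₀ ω < γ θ * n) := by
    refine ⟨fun h => hcon (Or.inl h), fun θ hθ h => hcon (Or.inr ?_)⟩
    exact Set.mem_iUnion₂.2 ⟨θ, hθ, h⟩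
  obtain ⟨hsum, hsepT⟩ := hcon'
  have hmem : θhat n ω ∈ S := ⟨hmin.1, hdist⟩
  obtain ⟨θ, hθT, hθb⟩ := Set.mem_iUnion₂.1 (hT hmem)
  have h1 := hsepT θ hθT
  have h2 : cvRandom K v ε X Y n (θhat n ω) ω ≤ cvRandom K v ε X Y n θ₀ ω := hmin.2 θ₀ hθ₀'
  have h3 := (abs_le.1 (hω n (θhat n ω) hmin.1 θ (hTS θ hθT).1)).1
  have h4 : ‖θhat n ω - θ‖ ≤ γ θ / (4 * D) := by
    rw [← dist_eq_norm]; exact le_of_lt hθb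
  have hγθ := hγpos θ
  have h5 : D * ‖θhat n ω - θ‖ * sumSqRandom v ε X Y n ω ≤
      D * (γ θ / (4 * D)) * (2 * n) := by
    have := sumSqRandom_nonneg (v := v) (ε := ε) (X := X) (Y := Y) n ω
    gcongr
    exact not_lt.1 hsum
  have h6 : D * (γ θ / (4 * D)) * (2 * n) = γ θ * n / 2 := by field_simp; ring
  have h7 : 0 < γ θ * n := mul_pos (hγpos θ) hn0
  rw [not_lt] at h1
  linarith

end Consistency

theorem mainTheorem4 {d p : ℕ} (hd : 1 ≤ d)
    -- parameter space and true parameter, in its interior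
    (a b : ℝ) (θ₀ : Fin p → ℝ) (hθ₀ : ∀ i, a < θ₀ i ∧ θ₀ i < b)
    -- regular model of correlation functions
    (K : (Fin p → ℝ) → EuclideanSpace ℝ (Fin d) → ℝ)
    (hK : IsRegularCovarianceModel a b K)
    (hK1 : ∀ θ ∈ paramCube p a b, K θ 0 = 1)
    -- perturbed regular grid
    (v : ℕ → Fin d → ℕ) (hv : IsGridEnumeration v)
    (ε : ℝ) (hε0 : 0 ≤ ε) (hε : ε < 1 / 2)
    (L : Measure (EuclideanSpace ℝ (Fin d))) (hL : IsPerturbationLaw L)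
    {ΩX ΩY : Type*} [MeasurableSpace ΩX] [MeasurableSpace ΩY]
    (PX : Measure ΩX) [IsProbabilityMeasure PX] (PY : Measure ΩY) [IsProbabilityMeasure PY]
    (X : ℕ → ΩX → EuclideanSpace ℝ (Fin d)) (hXm : ∀ i, Measurable (X i))
    (hXlaw : ∀ i, PX.map (X i) = L) (hXindep : iIndepFun X PX)
    -- Gaussian process, independent of the perturbations (product space)
    (Y : EuclideanSpace ℝ (Fin d) → ΩY → ℝ)
    (hY : IsCenteredGaussianProcess Y PY (K θ₀))
    -- the observations `y_i` are random variables
    (hYm : ∀ i, Measurable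
      (fun ω : ΩX × ΩY => Y (obsPoint v ε (fun j => X j ω.1) i) ω.2))
    -- any cross validation estimator
    (θhat : ℕ → ΩX × ΩY → Fin p → ℝ)
    (hθhat : IsCVEstimator a b K v ε PX X PY Y θhat) :
    (ε = 0 →
      (¬ ∃ θ ∈ paramCube p a b, θ ≠ θ₀ ∧
        ∀ u : Fin d → ℤ, K θ (WithLp.toLp 2 (fun k => (u k : ℝ))) =
          K θ₀ (WithLp.toLp 2 (fun k => (u k : ℝ)))) →
      TendstoInMeasure (PX.prod PY) θhat atTop (fun _ => θ₀)) ∧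
    (ε ≠ 0 →
      (¬ ∃ θ ∈ paramCube p a b, θ ≠ θ₀ ∧
        ∀ᵐ t ∂(volume.restrict (interpointSet ε L.support)), K θ t = K θ₀ t) →
      TendstoInMeasure (PX.prod PY) θhat atTop (fun _ => θ₀)) := by
  have hθ₀' : θ₀ ∈ paramCube p a b := fun i => ⟨(hθ₀ i).1.le, (hθ₀ i).2.le⟩
  have hLp := hL.prob
  refine ⟨fun h0 hid => ?_, fun _ hid => ?_⟩
  · subst h0
    refine tendstoInMeasure_of_isSeenByPairs hd hθ₀ hK hK1 hv hε0 hε hL hXm hXlaw hXindep hY hYm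
      hθhat fun θ hθ hne => isSeenByPairs_zero L (by simp [hK1 θ hθ, hK1 θ₀ hθ₀']) ?_
    by_contra! hcon
    exact hid ⟨θ, hθ, hne, fun u => sub_eq_zero.1 (hcon u)⟩
  · refine tendstoInMeasure_of_isSeenByPairs hd hθ₀ hK hK1 hv hε0 hε hL hXm hXlaw hXindep hY hYm
      hθhat fun θ hθ hne => isSeenByPairs_of_not_ae
        ((hK.continuous hθ).sub (hK.continuous hθ₀')) fun hcon => hid ⟨θ, hθ, hne, ?_⟩
    exact hcon.mono fun t ht => sub_eq_zero.1 ht
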